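/- Let $\omega \subset (0,1)$ be a measurable set with Lebesgue measure $|\omega| > 0$. All functions are real-valued. For $T > 0$, $y_0 \in L^2(0,1)$ and $u \in L^2((0,T)\times\omega)$, consider the controlled heat equation $$ \begin{cases} y_t - y_{xx} = u \mathbf{1}_\omega & \text{in } (0,T)\times(0,1),\\ y(t,0) = y(t,1) = 0 & \text{in } (0,T),\\ y(0,x) = y_0(x) & \text{in } (0,1), \end{cases} $$ whose solutions are understood in the space $C^0([0,T];L^2(0,1)) \cap L^2((0,T);H^1_0(0,1)) \cap H^1((0,T);H^{-1}(0,1))$, the equation holding in $H^{-1}(0,1)$ for almost every $t \in (0,T)$. Then the system is small-time null controllable: for every $T > 0$ and $y_0 \in L^2(0,1)$ there exists $u \in L^2((0,T)\times\omega)$ such that the system has a unique solution $y$, and $y(T) = 0$. Moreover, there exists a constant $C > 0$ (depending only on $\omega$) such that, for all $T > 0$ and $y_0 \in L^2(0,1)$, such a control $u$ can be chosen with $$ \|u\|_{L^2((0,T)\times\omega)} \le C e^{C/T} \|y_0\|_{L^2(0,1)}. $$ -/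

import Mathlib

open MeasureTheory Set

namespace HeatControl

/-- Test functions on the open interval `(a, b)`: smooth functions whose support is a compact
subset of `(a, b)`. -/
def IsTestFunction (a b : ℝ) (φ : ℝ → ℝ) : Prop :=
  ContDiff ℝ (⊤ : ℕ∞) φ ∧ HasCompactSupport φ ∧ tsupport φ ⊆ Ioo a b

/-- The real Hilbert space `L²(0,1)`. -/
abbrev L2 : Type := Lp ℝ 2 (volume.restrict (Ioo (0 : ℝ) 1))

/-- The space `L²((0,T) × ω)` of controls. -/
abbrev Control (ω : Set ℝ) (T : ℝ) : Type :=
  Lp ℝ 2 ((volume.restrict (Ioo (0 : ℝ) T)).prod (volume.restrict ω))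

/-- `H¹₀(0,1)` as a closed subspace of `L²(0,1) × L²(0,1)`, a function `v` being recorded as the
pair `(v, v')`: it is the closure of the test functions on `(0,1)` for the `H¹` norm
`(‖v‖² + ‖v'‖²)^(1/2)`. -/
noncomputable def H10Submodule : Submodule ℝ (WithLp 2 (L2 × L2)) :=
  (Submodule.span ℝ {p : WithLp 2 (L2 × L2) | ∃ φ : ℝ → ℝ, IsTestFunction 0 1 φ ∧
    p.fst =ᵐ[volume.restrict (Ioo (0 : ℝ) 1)] φ ∧
    p.snd =ᵐ[volume.restrict (Ioo (0 : ℝ) 1)] deriv φ}).topologicalClosure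

/-- The Hilbert space `H¹₀(0,1)`, with the `H¹` norm. -/
def H10 : Type := H10Submodule

noncomputable instance : NormedAddCommGroup H10 :=
  inferInstanceAs (NormedAddCommGroup H10Submodule)

noncomputable instance : InnerProductSpace ℝ H10 :=
  inferInstanceAs (InnerProductSpace ℝ H10Submodule)

instance : CompleteSpace H10 :=
  (Submodule.isClosed_topologicalClosure _).completeSpace_coe (α := WithLp 2 (L2 × L2))

/-- The inclusion of `H¹₀(0,1)` into `L²(0,1) × L²(0,1)`, `v ↦ (v, v')`. -/
noncomputable def H10.subtypeL : H10 →L[ℝ] WithLp 2 (L2 × L2) :=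
  H10Submodule.subtypeL

/-- The dual space `H⁻¹(0,1)` of `H¹₀(0,1)`. -/
abbrev HNegOne : Type := StrongDual ℝ H10

/-- The inclusion `H¹₀(0,1) → L²(0,1)`, `v ↦ v`. -/
noncomputable def H10.toL2 : H10 →L[ℝ] L2 :=
  (WithLp.fstL 2 ℝ L2 L2).comp H10.subtypeL

/-- The weak derivative `H¹₀(0,1) → L²(0,1)`, `v ↦ v'`. -/
noncomputable def H10.weakDeriv : H10 →L[ℝ] L2 :=
  (WithLp.sndL 2 ℝ L2 L2).comp H10.subtypeL

/-- The embedding `L²(0,1) → H⁻¹(0,1)`, `f ↦ (v ↦ ∫ f v)`. -/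
noncomputable def L2.toHNegOne (f : L2) : HNegOne :=
  (innerSL ℝ f).comp H10.toL2

/-- `g` is the weak time derivative on `(0,T)` of `f`, both with values in `H⁻¹(0,1)`. -/
def HasWeakTimeDeriv (T : ℝ) (f g : ℝ → HNegOne) : Prop :=
  ∀ φ : ℝ → ℝ, IsTestFunction 0 T φ →
    ∫ t in Ioo 0 T, deriv φ t • f t = -∫ t in Ioo 0 T, φ t • g t

/-- `y` is a solution on `[0,T]`, in the space
`C⁰([0,T]; L²(0,1)) ∩ L²((0,T); H¹₀(0,1)) ∩ H¹((0,T); H⁻¹(0,1))`, of the controlled heat equation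
`y_t - y_xx = u 1_ω` in `(0,T) × (0,1)`, `y(t,0) = y(t,1) = 0`, `y(0,·) = y₀`.

Below, `Y` is `y` seen as an element of `L²((0,T); H¹₀(0,1))`, which encodes the boundary
condition, and `y'` is the time derivative of `y`. The equation holds in `H⁻¹(0,1)` for almost
every time. Only the values of `y` on `[0,T]` matter. -/
structure IsSolution (ω : Set ℝ) (T : ℝ) (y₀ : L2) (u : Control ω T) (y : ℝ → L2) : Prop where
  continuousOn : ContinuousOn y (Icc 0 T)
  initial : y 0 = y₀
  equation : ∃ (Y : ℝ → H10) (y' : ℝ → HNegOne),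
    MemLp Y 2 (volume.restrict (Ioo 0 T)) ∧
    (∀ᵐ t ∂volume.restrict (Ioo 0 T), H10.toL2 (Y t) = y t) ∧
    MemLp y' 2 (volume.restrict (Ioo 0 T)) ∧
    HasWeakTimeDeriv T (fun t => L2.toHNegOne (y t)) y' ∧
    ∀ᵐ t ∂volume.restrict (Ioo 0 T), ∀ v : H10,
      y' t v + inner ℝ (H10.weakDeriv (Y t)) (H10.weakDeriv v)
        = ∫ x in ω, u (t, x) * H10.toL2 v x

/-- The control `u` steers `y₀` to zero in time `T`: there is exactly one associated solution on
`[0,T]`, and it vanishes at time `T`. -/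
def SteersToZero (ω : Set ℝ) (T : ℝ) (y₀ : L2) (u : Control ω T) : Prop :=
  ∃ y : ℝ → L2, IsSolution ω T y₀ u y ∧
    (∀ z : ℝ → L2, IsSolution ω T y₀ u z → EqOn z y (Icc 0 T)) ∧
    y T = 0

/-- Small-time null controllability of the heat equation controlled from `ω`. -/
def SmallTimeNullControllable (ω : Set ℝ) : Prop :=
  ∀ T : ℝ, 0 < T → ∀ y₀ : L2, ∃ u : Control ω T, SteersToZero ω T y₀ u

end HeatControl

namespace HeatControl

/-! In the orthonormal sine basis the equation decouples into scalar equations `c' = -λ c + f`,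
solved by `duhamel`. The value of a mode at time `T` is its free evolution plus the pairing of `u`
with an adjoint solution, so steering to zero is a moment problem in the Hilbert space of controls.
By duality (Hahn–Banach and Riesz, `exists_of_moment_bound`) it has a solution of norm at most `K
‖y₀‖` as soon as finite sums of eigenmodes satisfy the observability inequality: energy at time `T`
is at most `K²` times the energy seen in `ω` during `(0,T)`.

Observability follows the Lebeau–Robbiano strategy. A sum of the first `N` modes is observed from
`ω` at cost `exp(2aN)` (`spectral_inequality`), while the higher modes decay like `exp(-N²t)` or
faster. On an interval of length `δ`, a cutoff `N` of order `1/δ` lets dissipation beat the cost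
(`approximate_observability`). The resulting estimates telescope over dyadic intervals shrinking to
time zero, with a final constant of the form `C exp(C/T)`.

The spectral inequality for merely measurable `ω` is polynomial: a sine sum is `Q(cos πx) sin πx`
with `deg Q < N`. By Chebyshev's inequality the sum is small on a large part of `ω`. That part
contains well separated points, and Lagrange interpolation there bounds `Q` on all of `[-1,1]`
(`abs_eval_le_of_separated`).

It remains to match the modes with the weak formulation. The sines, suitably normalised, are also a
Hilbert basis of `H¹₀`, so that a solution can be assembled from its modes (`exists_isSolution`).
Conversely, the modes of any solution solve scalar weak equations, which gives uniqueness
(`IsSolution.eqOn`). -/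

/-! ### Test functions and the du Bois-Reymond lemma. -/

theorem IsTestFunction.exists_Icc {a b : ℝ} (hab : a < b) {φ : ℝ → ℝ} (h : IsTestFunction a b φ) :
    ∃ a' b', a < a' ∧ a' ≤ b' ∧ b' < b ∧ tsupport φ ⊆ Icc a' b' := by
  rcases (tsupport φ).eq_empty_or_nonempty with h0 | h0
  · exact ⟨(a + b) / 2, (a + b) / 2, by linarith, le_rfl, by linarith, by simp [h0]⟩
  · have hc : IsCompact (tsupport φ) := h.2.1
    have h1 := h.2.2 (hc.sInf_mem h0)
    have h2 := h.2.2 (hc.sSup_mem h0)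
    exact ⟨_, _, h1.1, csInf_le_csSup h0 hc.bddBelow hc.bddAbove, h2.2,
      fun x hx => ⟨csInf_le hc.bddBelow hx, le_csSup hc.bddAbove hx⟩⟩

theorem IsTestFunction.eq_zero_of_notMem {a b : ℝ} {φ : ℝ → ℝ} (h : IsTestFunction a b φ)
    {x : ℝ} (hx : x ∉ Ioo a b) : φ x = 0 :=
  image_eq_zero_of_notMem_tsupport fun h' => hx (h.2.2 h')

theorem IsTestFunction.continuous {a b : ℝ} {φ : ℝ → ℝ} (h : IsTestFunction a b φ) :
    Continuous φ := h.1.continuous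

theorem IsTestFunction.contDiff_one {a b : ℝ} {φ : ℝ → ℝ} (h : IsTestFunction a b φ) :
    ContDiff ℝ 1 φ := h.1.of_le (by exact_mod_cast le_top)

theorem IsTestFunction.continuous_deriv {a b : ℝ} {φ : ℝ → ℝ} (h : IsTestFunction a b φ) :
    Continuous (deriv φ) := h.contDiff_one.continuous_deriv_one

theorem IsTestFunction.contDiff_mul {a b : ℝ} {φ g : ℝ → ℝ} (h : IsTestFunction a b φ)
    (hg : ContDiff ℝ (⊤ : ℕ∞) g) : IsTestFunction a b (fun x => φ x * g x) :=
  ⟨h.1.mul hg, h.2.1.mul_right, (tsupport_mul_subset_left).trans h.2.2⟩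

theorem setIntegral_Ioo_eq_intervalIntegral {E : Type*} [NormedAddCommGroup E] [NormedSpace ℝ E]
    {a b : ℝ} (hab : a ≤ b) (f : ℝ → E) : ∫ x in Ioo a b, f x = ∫ x in a..b, f x := by
  rw [intervalIntegral.integral_of_le hab, integral_Ioc_eq_integral_Ioo]

theorem IsTestFunction.integral_eq {a b : ℝ} {φ : ℝ → ℝ} (h : IsTestFunction a b φ) (g : ℝ → ℝ) :
    ∫ x, φ x * g x = ∫ x in Ioo a b, φ x * g x := by
  symm
  apply setIntegral_eq_integral_of_forall_compl_eq_zero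
  intro x hx
  simp [h.eq_zero_of_notMem hx]

theorem exists_isTestFunction_integral_eq_one {a b : ℝ} (hab : a < b) :
    ∃ ψ : ℝ → ℝ, IsTestFunction a b ψ ∧ ∫ x in Ioo a b, ψ x = 1 := by
  let f : ContDiffBump ((a + b) / 2 : ℝ) :=
    ⟨(b - a) / 8, (b - a) / 4, by linarith, by linarith⟩
  have hs : tsupport (f.normed volume) ⊆ Ioo a b := by
    rw [f.tsupport_normed_eq, Real.closedBall_eq_Icc]
    apply Icc_subset_Ioo
    · change a < (a + b) / 2 - (b - a) / 4; linarith
    · change (a + b) / 2 + (b - a) / 4 < b; linarith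
  have ht : IsTestFunction a b (f.normed volume) :=
    ⟨f.contDiff_normed, f.hasCompactSupport_normed, hs⟩
  refine ⟨_, ht, ?_⟩
  have := ht.integral_eq (fun _ => 1)
  simp only [mul_one] at this
  rw [← this, f.integral_normed]

/-- A test function with zero mean is the derivative of a test function. -/
theorem IsTestFunction.exists_primitive {a b : ℝ} (hab : a < b) {η : ℝ → ℝ}
    (h : IsTestFunction a b η) (h0 : ∫ x in Ioo a b, η x = 0) :
    ∃ φ, IsTestFunction a b φ ∧ deriv φ = η := by
  obtain ⟨a', b', ha, hab', hb, hs⟩ := h.exists_Icc hab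
  have hd : deriv (fun x => ∫ t in a..x, η t) = η := by
    ext x
    exact h.continuous.deriv_integral _ _ _
  have hdiff : Differentiable ℝ (fun x => ∫ t in a..x, η t) := fun x =>
    (h.continuous.integral_hasStrictDerivAt a x).hasDerivAt.differentiableAt
  have hη : ∀ x, x ∉ Icc a' b' → η x = 0 := fun x hx =>
    image_eq_zero_of_notMem_tsupport fun h' => hx (hs h')
  have hz : ∀ x, x ∉ Icc a' b' → ∫ t in a..x, η t = 0 := by
    intro x hx
    rcases lt_or_ge x a' with h1 | h1
    · rw [intervalIntegral.integral_congr (g := fun _ => 0), intervalIntegral.integral_zero]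
      intro t ht
      apply hη
      intro h'
      have := ht.2
      simp only [le_sup_iff] at this
      rcases this with this | this <;> linarith [h'.1]
    · have h2 : b' < x := by
        by_contra h'
        exact hx ⟨h1, not_lt.1 h'⟩
      have e1 : ∫ t in x..b, η t = 0 := by
        rw [intervalIntegral.integral_congr (g := fun _ => 0), intervalIntegral.integral_zero]
        intro t ht
        apply hη
        intro h'
        have := ht.1
        simp only [inf_le_iff] at this
        rcases this with this | this <;> linarith [h'.2]
      rw [setIntegral_Ioo_eq_intervalIntegral hab.le,
        ← intervalIntegral.integral_add_adjacent_intervals (b := x)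
        (h.continuous.intervalIntegrable _ _) (h.continuous.intervalIntegrable _ _), e1] at h0
      simpa using h0
  have hts : tsupport (fun x => ∫ t in a..x, η t) ⊆ Icc a' b' := by
    apply closure_minimal _ isClosed_Icc
    intro x hx
    by_contra h'
    exact hx (hz x h')
  refine ⟨_, ⟨?_, ?_, hts.trans (Icc_subset_Ioo ha hb)⟩, hd⟩
  · rw [contDiff_infty_iff_deriv, hd]
    exact ⟨hdiff, h.1⟩
  · exact isCompact_Icc.of_isClosed_subset (isClosed_tsupport _) hts

/-- The lemma of du Bois-Reymond. -/
theorem ae_eq_const_of_integral_deriv_mul_eq_zero {a b : ℝ} (hab : a < b) {g : ℝ → ℝ}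
    (hg : IntegrableOn g (Ioo a b))
    (h : ∀ φ, IsTestFunction a b φ → ∫ x in Ioo a b, deriv φ x * g x = 0) :
    ∃ c : ℝ, ∀ᵐ x ∂volume.restrict (Ioo a b), g x = c := by
  obtain ⟨ψ₀, hψ₀, h1⟩ := exists_isTestFunction_integral_eq_one hab
  have hint : ∀ ψ : ℝ → ℝ, Continuous ψ → IntegrableOn (fun x => ψ x * g x) (Ioo a b) := by
    intro ψ hψ
    have h2 : IntegrableOn g (Icc a b) := by rwa [integrableOn_Icc_iff_integrableOn_Ioo]
    exact (h2.continuousOn_mul hψ.continuousOn isCompact_Icc).mono_set Ioo_subset_Icc_self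
  have hintψ : ∀ ψ : ℝ → ℝ, Continuous ψ → IntegrableOn ψ (Ioo a b) := fun ψ hψ =>
    (hψ.integrableOn_Icc).mono_set Ioo_subset_Icc_self
  set m := ∫ x in Ioo a b, ψ₀ x * g x with hm
  refine ⟨m, ?_⟩
  have key : ∀ᵐ x ∂volume, x ∈ Ioo a b → g x - m = 0 := by
    apply isOpen_Ioo.ae_eq_zero_of_integral_contDiff_smul_eq_zero
    · exact (hg.sub (hintψ _ continuous_const)).locallyIntegrableOn
    · intro ψ h1ψ h2ψ h3ψ
      have hψ : IsTestFunction a b ψ := ⟨h1ψ, h2ψ, h3ψ⟩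
      simp only [smul_eq_mul]
      rw [hψ.integral_eq (fun x => g x - m)]
      set I := ∫ x in Ioo a b, ψ x with hI
      -- Subtracting `I * ψ₀` removes the mean of `ψ`, so the difference is the derivative of a test
      -- function and the hypothesis applies to it.
      have hη : IsTestFunction a b (fun x => ψ x - I * ψ₀ x) := by
        refine ⟨hψ.1.sub (contDiff_const.mul hψ₀.1), hψ.2.1.sub (hψ₀.2.1.mul_left), ?_⟩
        refine (tsupport_sub _ _).trans (union_subset h3ψ ?_)
        exact (tsupport_mul_subset_right).trans hψ₀.2.2
      obtain ⟨φ, hφ, hd⟩ := hη.exists_primitive hab (by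
        rw [integral_sub (hintψ _ hψ.continuous) ((hintψ _ hψ₀.continuous).const_mul _),
          integral_const_mul, h1]; simp [hI])
      have h4 := h φ hφ
      rw [hd] at h4
      have e1 : ∫ x in Ioo a b, (ψ x - I * ψ₀ x) * g x
          = (∫ x in Ioo a b, ψ x * g x) - I * m := by
        rw [hm, ← integral_const_mul, ← integral_sub (hint _ hψ.continuous)
          ((hint _ hψ₀.continuous).const_mul _)]
        congr 1; ext x; ring
      have e2 : ∫ x in Ioo a b, ψ x * (g x - m) = (∫ x in Ioo a b, ψ x * g x) - I * m := by
        rw [hI, ← integral_mul_const, ← integral_sub (hint _ hψ.continuous)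
          ((hintψ _ hψ.continuous).mul_const _)]
        congr 1; ext x; ring
      rw [e2, ← e1, h4]
  rw [ae_restrict_iff' measurableSet_Ioo]
  filter_upwards [key] with x hx hx'
  linarith [hx hx']

/-- Integration by parts for the primitive of an integrable function. -/
theorem integral_deriv_mul_primitive {a b : ℝ} (hab : a ≤ b) {φ f : ℝ → ℝ} (hφ : ContDiff ℝ 1 φ)
    (hf : IntegrableOn f (Ioo a b)) (c : ℝ) :
    ∫ x in Ioo a b, deriv φ x * (c + ∫ s in a..x, f s)
      = φ b * (c + ∫ s in a..b, f s) - φ a * c - ∫ x in Ioo a b, φ x * f x := by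
  have hfi : IntervalIntegrable f volume a b := by
    rwa [intervalIntegrable_iff_integrableOn_Ioo_of_le hab]
  have hF : AbsolutelyContinuousOnInterval (fun x => c + ∫ s in a..x, f s) a b :=
    ((contDiff_const (c := c)).contDiffOn.absolutelyContinuousOnInterval).fun_add
      (hfi.absolutelyContinuousOnInterval_intervalIntegral (c := a) (by simp))
  have h1 := hF.integral_mul_deriv_eq_deriv_mul hφ.contDiffOn.absolutelyContinuousOnInterval
  rw [setIntegral_Ioo_eq_intervalIntegral hab, setIntegral_Ioo_eq_intervalIntegral hab]
  have h2 : ∫ x in a..b, deriv (fun x => c + ∫ s in a..x, f s) x * φ x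
      = ∫ x in a..b, φ x * f x := by
    apply intervalIntegral.integral_congr_ae
    filter_upwards [hfi.ae_hasDerivAt_integral] with x hx hx'
    rw [((hx (uIoc_subset_uIcc hx') a (by simp)).const_add c).deriv, mul_comm]
  rw [h2] at h1
  simp only [intervalIntegral.integral_same, add_zero] at h1
  rw [show (fun x => deriv φ x * (c + ∫ s in a..x, f s))
    = fun x => (c + ∫ s in a..x, f s) * deriv φ x from by ext; ring, h1]
  ring

/-! ### The scalar equation satisfied by each mode. -/

/-- The solution of `c' = - l c + f`, `c 0 = a`. -/
noncomputable def duhamel (l a : ℝ) (f : ℝ → ℝ) (t : ℝ) : ℝ :=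
  Real.exp (-(l * t)) * (a + ∫ s in (0 : ℝ)..t, Real.exp (l * s) * f s)

theorem duhamel_zero (l a : ℝ) (f : ℝ → ℝ) : duhamel l a f 0 = a := by simp [duhamel]

section Duhamel

variable {T l a : ℝ} {f : ℝ → ℝ}

theorem intervalIntegrable_exp_mul (hT : 0 ≤ T) (hf : IntegrableOn f (Ioo 0 T)) :
    IntervalIntegrable (fun s => Real.exp (l * s) * f s) volume 0 T := by
  have : IntervalIntegrable f volume 0 T := by
    rwa [intervalIntegrable_iff_integrableOn_Ioo_of_le hT]
  exact this.continuousOn_mul (by fun_prop)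

theorem duhamel_absolutelyContinuous (hT : 0 ≤ T) (hf : IntegrableOn f (Ioo 0 T)) :
    AbsolutelyContinuousOnInterval (duhamel l a f) 0 T := by
  have h1 : ContDiff ℝ 1 (fun t : ℝ => Real.exp (-(l * t))) := by fun_prop
  exact (h1.contDiffOn.absolutelyContinuousOnInterval).fun_mul
    (((contDiff_const (c := a)).contDiffOn.absolutelyContinuousOnInterval).fun_add
      ((intervalIntegrable_exp_mul hT hf).absolutelyContinuousOnInterval_intervalIntegral
        (c := 0) (by simp)))

theorem duhamel_continuousOn (hT : 0 ≤ T) (hf : IntegrableOn f (Ioo 0 T)) :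
    ContinuousOn (duhamel l a f) (Icc 0 T) := by
  have := (duhamel_absolutelyContinuous (l := l) (a := a) hT hf).continuousOn
  rwa [uIcc_of_le hT] at this

theorem duhamel_ae_hasDerivAt (hT : 0 ≤ T) (hf : IntegrableOn f (Ioo 0 T)) :
    ∀ᵐ t, t ∈ uIcc 0 T → HasDerivAt (duhamel l a f) (-(l * duhamel l a f t) + f t) t := by
  filter_upwards [(intervalIntegrable_exp_mul (l := l) hT hf).ae_hasDerivAt_integral] with t ht ht'
  have h1 := (ht ht' 0 (by simp)).const_add a
  have h2 : HasDerivAt (fun t : ℝ => Real.exp (-(l * t))) (Real.exp (-(l * t)) * (-l)) t := by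
    have := ((hasDerivAt_id t).const_mul l).neg.exp
    simpa using this
  have h3 := h2.mul h1
  convert! h3 using 1
  have h4 : Real.exp (-(l * t)) * (Real.exp (l * t) * f t) = f t := by
    rw [← mul_assoc, ← Real.exp_add]; simp
  rw [h4, duhamel]; ring

theorem duhamel_weak (hT : 0 ≤ T) (hf : IntegrableOn f (Ioo 0 T)) {φ : ℝ → ℝ}
    (hφ : IsTestFunction 0 T φ) :
    ∫ t in Ioo 0 T, deriv φ t * duhamel l a f t
      = -∫ t in Ioo 0 T, φ t * (-(l * duhamel l a f t) + f t) := by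
  have h1 := (duhamel_absolutelyContinuous (l := l) (a := a) hT hf).integral_mul_deriv_eq_deriv_mul
    hφ.contDiff_one.contDiffOn.absolutelyContinuousOnInterval
  rw [hφ.eq_zero_of_notMem (x := 0) (by simp), hφ.eq_zero_of_notMem (x := T) (by simp)] at h1
  rw [setIntegral_Ioo_eq_intervalIntegral hT, setIntegral_Ioo_eq_intervalIntegral hT]
  have h2 : ∫ x in 0..T, deriv (duhamel l a f) x * φ x
      = ∫ t in 0..T, φ t * (-(l * duhamel l a f t) + f t) := by
    apply intervalIntegral.integral_congr_ae
    filter_upwards [duhamel_ae_hasDerivAt (l := l) (a := a) hT hf] with x hx hx'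
    rw [(hx (uIoc_subset_uIcc hx')).deriv, mul_comm]
  rw [h2] at h1
  simp_rw [mul_comm (deriv φ _)]
  rw [h1]; ring

/-- Multiply the equation by `2c`, absorb `2cf ≤ l c² + l⁻¹ f²` and integrate. The first term on the
left gives continuity in `L²`, the second gives the `L²((0,T); H¹₀)` bound. -/
theorem duhamel_energy (hl : 0 < l) (hf : MemLp f 2 (volume.restrict (Ioo 0 T))) {t : ℝ}
    (ht : t ∈ Icc 0 T) :
    duhamel l a f t ^ 2 + l * ∫ s in (0 : ℝ)..t, duhamel l a f s ^ 2
      ≤ a ^ 2 + l⁻¹ * ∫ s in Ioo 0 T, f s ^ 2 := by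
  set c := duhamel l a f with hc
  have hft : MemLp f 2 (volume.restrict (Ioo 0 t)) :=
    hf.mono_measure (Measure.restrict_mono (Ioo_subset_Ioo_right ht.2) le_rfl)
  have hfi : IntegrableOn f (Ioo 0 t) := hft.integrable (by norm_num)
  have hac : AbsolutelyContinuousOnInterval c 0 t := duhamel_absolutelyContinuous ht.1 hfi
  have hcc : ContinuousOn c (uIcc 0 t) := hac.continuousOn
  have h1 := (hac.fun_mul hac).integral_deriv_eq_sub
  have h0 : c 0 = a := duhamel_zero _ _ _
  have hfi2 : IntervalIntegrable (fun s => f s ^ 2) volume 0 t := by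
    rw [intervalIntegrable_iff_integrableOn_Ioo_of_le ht.1]
    exact hft.integrable_sq
  have hci2 : IntervalIntegrable (fun s => c s ^ 2) volume 0 t :=
    (hcc.pow 2).intervalIntegrable
  have h2 : ∫ s in (0 : ℝ)..t, deriv (fun s => c s * c s) s
      ≤ ∫ s in (0 : ℝ)..t, (-(l * c s ^ 2) + l⁻¹ * f s ^ 2) := by
    apply intervalIntegral.integral_mono_ae_restrict ht.1 (hac.fun_mul hac).intervalIntegrable_deriv
    · exact (hci2.const_mul l).neg.add (hfi2.const_mul _)
    · rw [Filter.EventuallyLE, ae_restrict_iff' measurableSet_Icc]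
      filter_upwards [duhamel_ae_hasDerivAt (l := l) (a := a) ht.1 hfi] with s hs hs'
      rw [← uIcc_of_le ht.1] at hs'
      have := hs hs'
      have h7 : HasDerivAt (fun i => c i * c i) _ s := this.mul this
      rw [h7.deriv, ← hc]
      have h3 : 0 ≤ l⁻¹ * (l * c s - f s) ^ 2 := by positivity
      have h4 : l⁻¹ * (l * c s - f s) ^ 2 = l * c s ^ 2 - 2 * c s * f s + l⁻¹ * f s ^ 2 := by
        field_simp; ring
      linarith
  have h8 : IntervalIntegrable (fun s => -(l * c s ^ 2)) volume 0 t := (hci2.const_mul l).neg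
  rw [h1, intervalIntegral.integral_add h8 (hfi2.const_mul _),
    intervalIntegral.integral_neg, intervalIntegral.integral_const_mul,
    intervalIntegral.integral_const_mul, h0] at h2
  have h5 : ∫ s in (0 : ℝ)..t, f s ^ 2 ≤ ∫ s in Ioo 0 T, f s ^ 2 := by
    rw [← setIntegral_Ioo_eq_intervalIntegral ht.1]
    exact setIntegral_mono_set hf.integrable_sq (Filter.Eventually.of_forall fun _ => sq_nonneg _)
      (Ioo_subset_Ioo_right ht.2).eventuallyLE
  have h6 := mul_le_mul_of_nonneg_left h5 (inv_nonneg.2 hl.le)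
  nlinarith

end Duhamel

/-! ### The sine basis of `L²(0,1)`. -/

instance : IsFiniteMeasure (volume.restrict (Ioo (0 : ℝ) 1)) := ⟨by simp⟩

theorem memLp_of_continuous {f : ℝ → ℝ} (hf : Continuous f) (a b : ℝ) :
    MemLp f 2 (volume.restrict (Ioo a b)) := by
  obtain ⟨C, hC⟩ := isCompact_Icc.exists_bound_of_continuousOn (s := Icc a b) hf.continuousOn
  have : IsFiniteMeasure (volume.restrict (Ioo a b)) := ⟨by simp⟩
  refine MemLp.of_bound hf.aestronglyMeasurable C ?_
  rw [ae_restrict_iff' measurableSet_Ioo]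
  exact Filter.Eventually.of_forall fun x hx => hC x (Ioo_subset_Icc_self hx)

/-- A continuous function as an element of `L²(0,1)`. -/
noncomputable def ofContinuous (f : ℝ → ℝ) (hf : Continuous f) : L2 :=
  (memLp_of_continuous hf 0 1).toLp f

theorem coeFn_ofContinuous {f : ℝ → ℝ} (hf : Continuous f) :
    ofContinuous f hf =ᵐ[volume.restrict (Ioo (0 : ℝ) 1)] f := MemLp.coeFn_toLp _

theorem L2.inner_eq (f g : L2) : inner ℝ f g = ∫ x in Ioo (0 : ℝ) 1, f x * g x := by
  rw [MeasureTheory.L2.inner_def]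
  simp [mul_comm]

theorem inner_ofContinuous_left {f : ℝ → ℝ} (hf : Continuous f) (g : L2) :
    inner ℝ (ofContinuous f hf) g = ∫ x in Ioo (0 : ℝ) 1, f x * g x := by
  rw [L2.inner_eq]
  apply integral_congr_ae
  filter_upwards [coeFn_ofContinuous hf] with x hx
  rw [hx]

theorem inner_ofContinuous {f g : ℝ → ℝ} (hf : Continuous f) (hg : Continuous g) :
    inner ℝ (ofContinuous f hf) (ofContinuous g hg) = ∫ x in Ioo (0 : ℝ) 1, f x * g x := by
  rw [inner_ofContinuous_left]
  apply integral_congr_ae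
  filter_upwards [coeFn_ofContinuous hg] with x hx
  rw [hx]

/-- The frequencies `(k + 1) π`. -/
noncomputable def freq (k : ℕ) : ℝ := (k + 1) * Real.pi

/-- The eigenvalues `((k + 1) π)²` of the Dirichlet Laplacian. -/
noncomputable def eigval (k : ℕ) : ℝ := freq k ^ 2

/-- The normalised eigenfunctions of the Dirichlet Laplacian. -/
noncomputable def sineFn (k : ℕ) (x : ℝ) : ℝ := √2 * Real.sin (freq k * x)

/-- The derivatives of the eigenfunctions. -/
noncomputable def sineDeriv (k : ℕ) (x : ℝ) : ℝ := √2 * freq k * Real.cos (freq k * x)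

theorem freq_pos (k : ℕ) : 0 < freq k := by unfold freq; positivity

theorem eigval_pos (k : ℕ) : 0 < eigval k := pow_pos (freq_pos k) 2

theorem eigval_mono : Monotone eigval := by
  intro i j h
  have : (i : ℝ) ≤ j := by exact_mod_cast h
  unfold eigval freq
  gcongr

theorem continuous_sineFn (k : ℕ) : Continuous (sineFn k) := by unfold sineFn; fun_prop

theorem continuous_sineDeriv (k : ℕ) : Continuous (sineDeriv k) := by unfold sineDeriv; fun_prop

theorem hasDerivAt_sineFn (k : ℕ) (x : ℝ) : HasDerivAt (sineFn k) (sineDeriv k x) x := by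
  have := (((hasDerivAt_id x).const_mul (freq k)).sin).const_mul (√2)
  convert! this using 1
  simp [sineDeriv]; ring

theorem hasDerivAt_sineDeriv (k : ℕ) (x : ℝ) :
    HasDerivAt (sineDeriv k) (-(eigval k * sineFn k x)) x := by
  have := (((hasDerivAt_id x).const_mul (freq k)).cos).const_mul (√2 * freq k)
  convert! this using 1
  simp [sineFn, eigval]; ring

theorem contDiff_sineFn (k : ℕ) : ContDiff ℝ (⊤ : ℕ∞) (sineFn k) := by unfold sineFn; fun_prop

theorem sineFn_zero (k : ℕ) : sineFn k 0 = 0 := by simp [sineFn]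

theorem sineFn_one (k : ℕ) : sineFn k 1 = 0 := by
  have := Real.sin_nat_mul_pi (k + 1)
  push_cast at this
  simp [sineFn, freq, this]

/-- The eigenfunctions as elements of `L²(0,1)`. -/
noncomputable def sine (k : ℕ) : L2 := ofContinuous (sineFn k) (continuous_sineFn k)

theorem integral_cos_int_mul_pi (j : ℤ) (hj : j ≠ 0) :
    ∫ x in (0 : ℝ)..1, Real.cos (j * Real.pi * x) = 0 := by
  have hc : (j * Real.pi : ℝ) ≠ 0 := mul_ne_zero (by exact_mod_cast hj) Real.pi_ne_zero
  rw [intervalIntegral.integral_comp_mul_left (fun x => Real.cos x) hc]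
  simp [Real.sin_int_mul_pi]

theorem orthonormal_sine : Orthonormal ℝ sine := by
  rw [orthonormal_iff_ite]
  intro i j
  rw [sine, sine, inner_ofContinuous, setIntegral_Ioo_eq_intervalIntegral zero_le_one]
  have h : ∀ x, sineFn i x * sineFn j x
      = Real.cos (((i - j : ℤ) : ℝ) * Real.pi * x) - Real.cos (((i + j + 2 : ℤ) : ℝ) * Real.pi * x) := by
    intro x
    rw [Real.cos_sub_cos]
    push_cast
    have h2 : √2 * √2 = (2 : ℝ) := Real.mul_self_sqrt (by norm_num)
    rw [show ((i - j : ℝ) * Real.pi * x + (i + j + 2) * Real.pi * x) / 2 = freq i * x by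
        unfold freq; ring,
      show ((i - j : ℝ) * Real.pi * x - (i + j + 2) * Real.pi * x) / 2 = -(freq j * x) by
        unfold freq; ring, Real.sin_neg, sineFn, sineFn]
    linear_combination (Real.sin (freq i * x) * Real.sin (freq j * x)) * h2
  simp_rw [h]
  rw [intervalIntegral.integral_sub (by apply Continuous.intervalIntegrable; fun_prop)
    (by apply Continuous.intervalIntegrable; fun_prop),
    integral_cos_int_mul_pi (i + j + 2) (by positivity)]
  split_ifs with hij
  · subst hij; simp
  · rw [integral_cos_int_mul_pi _ (by
      intro h0
      exact hij (by exact_mod_cast (sub_eq_zero.1 h0)))]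
    simp

theorem integrable_continuous_mul (f : L2) {g : ℝ → ℝ} (hg : Continuous g) :
    Integrable (fun x => f x * g x) (volume.restrict (Ioo (0 : ℝ) 1)) :=
  (Lp.memLp f).integrable_mul (memLp_of_continuous hg 0 1)

/-- The identity `2 sin((k+1)θ) cos θ = sin((k+2)θ) + sin(kθ)` trades one power of the cosine for a
shift of the frequency; hence the induction on `n` with `k` arbitrary. -/
theorem integral_mul_cos_pow_mul_sin (f : L2) (hf : ∀ k, inner ℝ (sine k) f = 0) (n : ℕ) :
    ∀ k : ℕ, ∫ x in Ioo (0 : ℝ) 1,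
      f x * (Real.cos (Real.pi * x) ^ n * Real.sin (k * Real.pi * x)) = 0 := by
  induction n with
  | zero =>
    intro k
    rcases k with _ | k
    · simp
    · have := hf k
      rw [sine, inner_ofContinuous_left] at this
      have h2 : (√2 : ℝ) ≠ 0 := by positivity
      rw [← mul_right_inj' h2, mul_zero, ← integral_const_mul]
      refine Eq.trans ?_ this
      congr 1; ext x
      simp only [sineFn, freq]; push_cast; ring
  | succ n ih =>
    intro k
    rcases k with _ | k
    · simp
    · have h : ∀ x : ℝ, f x * (Real.cos (Real.pi * x) ^ (n + 1) * Real.sin ((k + 1 : ℕ) * Real.pi * x))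
          = (1 / 2) * (f x * (Real.cos (Real.pi * x) ^ n * Real.sin ((k + 2 : ℕ) * Real.pi * x)))
          + (1 / 2) * (f x * (Real.cos (Real.pi * x) ^ n * Real.sin (k * Real.pi * x))) := by
        intro x
        have h1 : Real.sin ((k + 2 : ℕ) * Real.pi * x) + Real.sin (k * Real.pi * x)
            = 2 * Real.sin ((k + 1 : ℕ) * Real.pi * x) * Real.cos (Real.pi * x) := by
          rw [Real.two_mul_sin_mul_cos]
          push_cast
          rw [show ((k : ℝ) + 1) * Real.pi * x - Real.pi * x = k * Real.pi * x by ring,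
            show ((k : ℝ) + 1) * Real.pi * x + Real.pi * x = (k + 2) * Real.pi * x by ring]
          ring
        linear_combination (-(1 / 2) * f x * Real.cos (Real.pi * x) ^ n) * h1
      simp_rw [h]
      rw [integral_add, integral_const_mul, integral_const_mul, ih, ih]
      · simp
      · exact (integrable_continuous_mul f (by fun_prop)).const_mul _
      · exact (integrable_continuous_mul f (by fun_prop)).const_mul _

theorem integral_mul_sin_mul_polynomial (f : L2) (hf : ∀ k, inner ℝ (sine k) f = 0)
    (p : Polynomial ℝ) :
    ∫ x in Ioo (0 : ℝ) 1, f x * (p.eval (Real.cos (Real.pi * x)) * Real.sin (Real.pi * x)) = 0 := by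
  simp_rw [Polynomial.eval_eq_sum_range, Finset.sum_mul, Finset.mul_sum]
  rw [integral_finsetSum]
  · apply Finset.sum_eq_zero
    intro n _
    have := integral_mul_cos_pow_mul_sin f hf n 1
    refine Eq.trans ?_ (mul_eq_zero_of_right (p.coeff n) this)
    rw [← integral_const_mul]
    congr 1; ext x; push_cast; ring_nf
  · intro n _
    exact integrable_continuous_mul f (by fun_prop)

/-- Completeness through Weierstrass in the variable `s = cos πx`: a test function `φ` is a uniform
limit of polynomials in `cos πx`, and `f sin πx` is orthogonal to all of these. So `f sin πx = 0`
almost everywhere, and the sine is positive inside the interval. -/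
theorem eq_zero_of_inner_sine_eq_zero (f : L2) (hf : ∀ k, inner ℝ (sine k) f = 0) : f = 0 := by
  have hfi : Integrable f (volume.restrict (Ioo (0 : ℝ) 1)) :=
    (Lp.memLp f).integrable (by norm_num)
  have hs : Continuous fun x : ℝ => Real.sin (Real.pi * x) := by fun_prop
  have key : ∀ᵐ x ∂volume, x ∈ Ioo (0 : ℝ) 1 → f x * Real.sin (Real.pi * x) = 0 := by
    apply isOpen_Ioo.ae_eq_zero_of_integral_contDiff_smul_eq_zero
    · have : IntegrableOn (fun x => f x * Real.sin (Real.pi * x)) (Ioo 0 1) :=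
        integrable_continuous_mul f hs
      exact this.locallyIntegrableOn
    · intro φ h1 h2 h3
      have hφ : IsTestFunction 0 1 φ := ⟨h1, h2, h3⟩
      simp only [smul_eq_mul]
      rw [hφ.integral_eq (fun x => f x * Real.sin (Real.pi * x))]
      by_contra hne
      set J := ∫ x in Ioo (0 : ℝ) 1, φ x * (f x * Real.sin (Real.pi * x)) with hJ
      set M := ∫ x in Ioo (0 : ℝ) 1, |f x| with hM
      have hM0 : 0 ≤ M := integral_nonneg fun x => abs_nonneg _
      have hε : 0 < |J| / (M + 1) := by positivity
      obtain ⟨p, hp⟩ := exists_polynomial_near_of_continuousOn (-1) 1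
        (fun s => φ (Real.arccos s / Real.pi))
        (hφ.continuous.comp (Real.continuous_arccos.div_const _)).continuousOn _ hε
      have e1 : J = ∫ x in Ioo (0 : ℝ) 1,
          f x * ((φ x - p.eval (Real.cos (Real.pi * x))) * Real.sin (Real.pi * x)) := by
        have h5 := integral_mul_sin_mul_polynomial f hf p
        refine (sub_zero J).symm.trans ((congrArg (J - ·) h5.symm).trans ?_)
        rw [hJ, ← integral_sub]
        · congr 1; ext x; ring
        · have := integrable_continuous_mul f (hφ.continuous.mul hs)
          exact this.congr (Filter.Eventually.of_forall fun x => by simp; ring)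
        · exact integrable_continuous_mul f (by fun_prop)
      have e2 : |J| ≤ ∫ x in Ioo (0 : ℝ) 1, |J| / (M + 1) * |f x| := by
        conv_lhs => rw [e1]
        rw [← Real.norm_eq_abs]
        apply norm_integral_le_of_norm_le (hfi.abs.const_mul _)
        rw [ae_restrict_iff' measurableSet_Ioo]
        refine Filter.Eventually.of_forall fun x hx => ?_
        have h6 := hp (Real.cos (Real.pi * x)) ⟨Real.neg_one_le_cos _, Real.cos_le_one _⟩
        rw [Real.arccos_cos (by have := hx.1; positivity)
          (by nlinarith [hx.2, Real.pi_pos]), mul_div_cancel_left₀ _ Real.pi_ne_zero,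
          abs_sub_comm] at h6
        rw [Real.norm_eq_abs, abs_mul, abs_mul, mul_comm]
        have h7 := Real.abs_sin_le_one (Real.pi * x)
        have : |φ x - p.eval (Real.cos (Real.pi * x))| * |Real.sin (Real.pi * x)|
            ≤ |J| / (M + 1) * 1 := by gcongr
        rw [mul_one] at this
        gcongr
      rw [integral_const_mul, ← hM, div_mul_eq_mul_div, le_div_iff₀ (by positivity)] at e2
      have : 0 < |J| := abs_pos.2 hne
      nlinarith
  apply Lp.ext
  have h0 : ∀ᵐ x ∂volume.restrict (Ioo (0 : ℝ) 1), f x = 0 := by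
    rw [ae_restrict_iff' measurableSet_Ioo]
    filter_upwards [key] with x hx hx'
    have : 0 < Real.sin (Real.pi * x) := Real.sin_pos_of_pos_of_lt_pi
      (by have := hx'.1; positivity) (by nlinarith [hx'.2, Real.pi_pos])
    exact (mul_eq_zero.1 (hx hx')).resolve_right this.ne'
  filter_upwards [h0, Lp.coeFn_zero ℝ 2 (volume.restrict (Ioo (0 : ℝ) 1))] with x hx h1
  rw [hx, h1]; rfl

theorem orthogonal_span_range_eq_bot {H : Type*} [NormedAddCommGroup H] [InnerProductSpace ℝ H]
    {b : ℕ → H} (h : ∀ v, (∀ k, inner ℝ (b k) v = 0) → v = 0) :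
    (Submodule.span ℝ (range b))ᗮ = ⊥ := by
  rw [Submodule.eq_bot_iff]
  intro v hv
  exact h v fun k => (Submodule.mem_orthogonal _ _).1 hv _ (Submodule.subset_span ⟨k, rfl⟩)

/-- The eigenfunctions form a Hilbert basis of `L²(0,1)`. -/
noncomputable def sineBasis : HilbertBasis ℕ ℝ L2 :=
  HilbertBasis.mkOfOrthogonalEqBot orthonormal_sine
    (orthogonal_span_range_eq_bot eq_zero_of_inner_sine_eq_zero)

theorem sineBasis_apply (k : ℕ) : sineBasis k = sine k := by simp [sineBasis]

/-! ### The spectral inequality. -/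

/-- Sine polynomials. -/
noncomputable def sineSum (N : ℕ) (b : ℕ → ℝ) (x : ℝ) : ℝ :=
  ∑ k ∈ Finset.range N, b k * sineFn k x

theorem continuous_sineSum (N : ℕ) (b : ℕ → ℝ) : Continuous (sineSum N b) :=
  continuous_finsetSum _ fun k _ => continuous_const.mul (continuous_sineFn k)

theorem coeFn_sum_smul_toLp {α : Type*} [MeasurableSpace α] {μ : Measure α} {f : ℕ → α → ℝ}
    (hf : ∀ k, MemLp (f k) 2 μ) (b : ℕ → ℝ) (S : Finset ℕ) :
    (∑ k ∈ S, b k • (hf k).toLp (f k) : Lp ℝ 2 μ) =ᵐ[μ] fun x => ∑ k ∈ S, b k * f k x := by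
  have h := ae_all_iff.2 fun k => (Lp.coeFn_smul (b k) ((hf k).toLp (f k))).and (hf k).coeFn_toLp
  filter_upwards [Lp.coeFn_fun_finsetSum S fun k => b k • (hf k).toLp (f k), h] with x h1 h2
  rw [h1]
  refine Finset.sum_congr rfl fun k _ => ?_
  rw [(h2 k).1, Pi.smul_apply, (h2 k).2, smul_eq_mul]

theorem coeFn_sum_smul_sine (N : ℕ) (b : ℕ → ℝ) :
    (∑ k ∈ Finset.range N, b k • sine k : L2) =ᵐ[volume.restrict (Ioo (0 : ℝ) 1)] sineSum N b :=
  coeFn_sum_smul_toLp (fun k => memLp_of_continuous (continuous_sineFn k) 0 1) b _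

theorem integral_sineSum_sq (N : ℕ) (b : ℕ → ℝ) :
    ∫ x in Ioo (0 : ℝ) 1, sineSum N b x ^ 2 = ∑ k ∈ Finset.range N, b k ^ 2 := by
  have h1 := orthonormal_sine.inner_sum b b (Finset.range N)
  rw [L2.inner_eq] at h1
  simp only [conj_trivial, ← pow_two] at h1
  rw [← h1]
  apply integral_congr_ae
  filter_upwards [coeFn_sum_smul_sine N b] with x hx
  rw [hx]

/-- Greedy choice: take a point almost at the infimum of `E` and discard the part of `E` within `d`
to its right. This costs barely more than `d` of measure, and the strict inequality pays for the
excess. -/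
theorem exists_separated_points {d : ℝ} (hd : 0 < d) (n : ℕ) :
    ∀ E : Set ℝ, BddBelow E → ENNReal.ofReal (n * d) < volume E →
      ∃ x : ℕ → ℝ, (∀ i ≤ n, x i ∈ E) ∧ ∀ i < n, x i + d ≤ x (i + 1) := by
  induction n with
  | zero =>
    intro E _ hE
    have : E.Nonempty := by
      rw [nonempty_iff_ne_empty]
      rintro rfl
      simp at hE
    obtain ⟨y, hy⟩ := this
    exact ⟨fun _ => y, fun _ _ => hy, fun i hi => absurd hi (Nat.not_lt_zero _)⟩
  | succ n ih =>
    intro E hb hE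
    have hne : E.Nonempty := by
      rw [nonempty_iff_ne_empty]
      rintro rfl
      simp at hE
    obtain ⟨r, hr0, hr1, hr2⟩ := ENNReal.lt_iff_exists_real_btwn.1 hE
    have hr : ((n + 1 : ℕ) : ℝ) * d < r := (ENNReal.ofReal_lt_ofReal_iff_of_nonneg (by positivity)).1 hr1
    obtain ⟨y, hyE, hy⟩ := exists_lt_of_csInf_lt hne
      (show sInf E < sInf E + (r - ((n + 1 : ℕ) : ℝ) * d) by linarith)
    have hE' : ENNReal.ofReal (n * d) < volume (E ∩ Ici (y + d)) := by
      by_contra hcon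
      rw [not_lt] at hcon
      have hsub : E ⊆ Ico (sInf E) (y + d) ∪ (E ∩ Ici (y + d)) := by
        intro z hz
        rcases lt_or_ge z (y + d) with h | h
        · exact Or.inl ⟨csInf_le hb hz, h⟩
        · exact Or.inr ⟨hz, h⟩
      have h1 : volume E ≤ ENNReal.ofReal (y + d - sInf E) + ENNReal.ofReal (n * d) := by
        calc volume E ≤ _ := measure_mono hsub
          _ ≤ _ := measure_union_le _ _
          _ ≤ _ := by rw [Real.volume_Ico]; gcongr
      have h2 : sInf E ≤ y := csInf_le hb hyE
      rw [← ENNReal.ofReal_add (by linarith) (by positivity)] at h1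
      refine absurd (hr2.trans_le h1) (not_lt.2 (ENNReal.ofReal_le_ofReal ?_))
      push_cast at hy
      linarith
    obtain ⟨x, hx1, hx2⟩ := ih _ (hb.mono inter_subset_left) hE'
    -- The new point `y` is put in front of the inductively given sequence.
    refine ⟨fun i => Nat.casesOn i y x, ?_, ?_⟩
    · intro i hi
      rcases i with _ | i
      · exact hyE
      · exact (hx1 i (by omega)).1
    · intro i hi
      rcases i with _ | i
      · exact (hx1 0 (by omega)).2
      · exact hx2 i (by omega)

theorem separated_le_sub {d : ℝ} {n : ℕ} {x : ℕ → ℝ} (h : ∀ i < n, x i + d ≤ x (i + 1)) {i j : ℕ}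
    (hij : i ≤ j) (hj : j ≤ n) : ((j : ℝ) - i) * d ≤ x j - x i := by
  induction j, hij using Nat.le_induction with
  | base => simp
  | succ j hij ih =>
    have h1 := ih (by omega)
    have h2 := h j (by omega)
    push_cast
    linarith

theorem separated_le_abs_sub {d : ℝ} {n : ℕ} {x : ℕ → ℝ}
    (h : ∀ i < n, x i + d ≤ x (i + 1)) {i j : ℕ} (hi : i ≤ n) (hj : j ≤ n) :
    |(j : ℝ) - i| * d ≤ |x j - x i| := by
  rcases le_total i j with hij | hij
  · rw [abs_of_nonneg (by simpa using hij)]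
    exact (separated_le_sub h hij hj).trans (le_abs_self _)
  · rw [abs_sub_comm, abs_sub_comm (x j), abs_of_nonneg (by simpa using hij)]
    exact (separated_le_sub h hij hi).trans (le_abs_self _)

theorem prod_abs_sub_eq {n j : ℕ} (hj : j ≤ n) :
    ∏ i ∈ (Finset.range (n + 1)).erase j, |(j : ℝ) - i| = (j.factorial * (n - j).factorial : ℕ) := by
  have hs : (Finset.range (n + 1)).erase j = Finset.range j ∪ Finset.Ico (j + 1) (n + 1) := by
    ext i; simp only [Finset.mem_erase, Finset.mem_range, Finset.mem_union, Finset.mem_Ico]; omega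
  have hd : Disjoint (Finset.range j) (Finset.Ico (j + 1) (n + 1)) := by
    rw [Finset.disjoint_left]; intro i; simp only [Finset.mem_range, Finset.mem_Ico]; omega
  rw [hs, Finset.prod_union hd, Nat.cast_mul]
  congr 1
  · rw [← Finset.prod_range_add_one_eq_factorial, ← Finset.prod_range_reflect, Nat.cast_prod]
    apply Finset.prod_congr rfl
    intro i hi
    rw [Finset.mem_range] at hi
    rw [abs_of_nonneg (by simp; omega), show j - 1 - i = j - (i + 1) by omega,
      Nat.cast_sub (by omega)]
    push_cast; ring
  · rw [← Finset.prod_range_add_one_eq_factorial, Finset.prod_Ico_eq_prod_range, Nat.cast_prod,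
      show n + 1 - (j + 1) = n - j by omega]
    apply Finset.prod_congr rfl
    intro i _
    push_cast
    rw [show (j : ℝ) - (j + 1 + i) = -((i : ℝ) + 1) by ring, abs_neg, abs_of_nonneg (by positivity)]

theorem factorial_div_two_pow_le {n j : ℕ} (hj : j ≤ n) :
    (n.factorial : ℝ) / 2 ^ n ≤ (j.factorial * (n - j).factorial : ℕ) := by
  rw [div_le_iff₀ (by positivity)]
  have h1 := Nat.choose_mul_factorial_mul_factorial hj
  have h2 : n.choose j ≤ 2 ^ n := Nat.choose_le_two_pow n j
  have h3 : n.factorial ≤ j.factorial * (n - j).factorial * 2 ^ n := by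
    calc n.factorial = n.choose j * (j.factorial * (n - j).factorial) := by rw [← h1]; ring
      _ ≤ 2 ^ n * (j.factorial * (n - j).factorial) := Nat.mul_le_mul_right _ h2
      _ = _ := by ring
  exact_mod_cast h3

/-- A Remez type inequality: a polynomial of degree `n` bounded by `B` at `n + 1` points of
`[-1, 1]` with `i`-th and `j`-th points at distance at least `c |i - j|`. -/
theorem abs_eval_le_of_separated {n : ℕ} {Q : Polynomial ℝ} (hQ : Q.degree < (n + 1 : ℕ))
    {s : ℕ → ℝ} {c B : ℝ} (hc : 0 < c) (hB : 0 ≤ B) (hs : ∀ i ≤ n, |s i| ≤ 1)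
    (hsep : ∀ i ≤ n, ∀ j ≤ n, c * |(j : ℝ) - i| ≤ |s j - s i|)
    (hb : ∀ i ≤ n, |Q.eval (s i)| ≤ B) {t : ℝ} (ht : |t| ≤ 1) :
    |Q.eval t| ≤ (n + 1) * (B * ((4 / c) ^ n / n.factorial)) := by
  have hinj : Set.InjOn s (Finset.range (n + 1)) := by
    intro i hi j hj hij
    simp only [Finset.coe_range, mem_Iio] at hi hj
    have := hsep i (by omega) j (by omega)
    rw [hij, sub_self, abs_zero] at this
    have h2 : |(j : ℝ) - i| = 0 := le_antisymm (by nlinarith [abs_nonneg ((j : ℝ) - i)]) (abs_nonneg _)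
    rw [abs_eq_zero, sub_eq_zero] at h2
    exact_mod_cast h2.symm
  have hint := Lagrange.eq_interpolate (s := Finset.range (n + 1)) (v := s) hinj (f := Q)
    (by simpa using hQ)
  rw [hint, Lagrange.interpolate_apply, Polynomial.eval_finsetSum]
  refine (Finset.abs_sum_le_sum_abs _ _).trans ?_
  have hterm : ∀ j ∈ Finset.range (n + 1),
      |Polynomial.eval t (Polynomial.C (Q.eval (s j)) * Lagrange.basis (Finset.range (n + 1)) s j)|
        ≤ B * ((4 / c) ^ n / n.factorial) := by
    intro j hj
    have hj' : j ≤ n := by rw [Finset.mem_range] at hj; omega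
    rw [Polynomial.eval_mul, Polynomial.eval_C, abs_mul]
    refine mul_le_mul (hb j hj') ?_ (abs_nonneg _) hB
    rw [Lagrange.basis, Polynomial.eval_prod, Finset.abs_prod]
    have hcard : ((Finset.range (n + 1)).erase j).card = n := by
      rw [Finset.card_erase_of_mem hj, Finset.card_range]; omega
    -- In each Lagrange factor the numerator is at most 2 and the denominator at least `c |j - i|`.
    -- The product of the `|j - i|` is `j! (n-j)!`, which is at least `n! / 2^n` because binomial
    -- coefficients are at most `2^n`.
    calc _ ≤ ∏ i ∈ (Finset.range (n + 1)).erase j, (2 / c) / |(j : ℝ) - i| := by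
          apply Finset.prod_le_prod
          · intro i _; exact abs_nonneg _
          · intro i hi
            have hi' : i ≤ n := by
              have := Finset.mem_of_mem_erase hi
              rw [Finset.mem_range] at this; omega
            have hne : 0 < |(j : ℝ) - i| := by
              rw [abs_pos, sub_ne_zero]
              exact_mod_cast (Finset.ne_of_mem_erase hi).symm
            rw [Lagrange.basisDivisor, Polynomial.eval_mul, Polynomial.eval_C, Polynomial.eval_sub,
              Polynomial.eval_X, Polynomial.eval_C, abs_mul, abs_inv, inv_mul_eq_div, div_div]
            have h1 : |t - s i| ≤ 2 := by
              have := abs_sub t (s i)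
              have := hs i hi'
              linarith
            exact div_le_div₀ (by norm_num) h1 (by positivity) (hsep i hi' j hj')
      _ = (2 / c) ^ n / (j.factorial * (n - j).factorial : ℕ) := by
          rw [Finset.prod_div_distrib, Finset.prod_const, hcard, prod_abs_sub_eq hj']
      _ ≤ (2 / c) ^ n / ((n.factorial : ℝ) / 2 ^ n) := by
          apply div_le_div_of_nonneg_left (by positivity) (by positivity)
            (factorial_div_two_pow_le hj')
      _ = _ := by
          rw [div_div_eq_mul_div, ← mul_pow]; congr 2; ring
  refine (Finset.sum_le_sum hterm).trans ?_
  simp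

theorem two_mul_le_sin_pi_mul {η x : ℝ} (h1 : η ≤ x) (h2 : x ≤ 1 - η) (h0 : 0 ≤ η) :
    2 * η ≤ Real.sin (Real.pi * x) := by
  have key : ∀ y : ℝ, 0 ≤ y → y ≤ 1 / 2 → 2 * y ≤ Real.sin (Real.pi * y) := by
    intro y hy hy'
    have := Real.mul_le_sin (x := Real.pi * y) (by positivity) (by nlinarith [Real.pi_pos])
    have e : 2 / Real.pi * (Real.pi * y) = 2 * y := by field_simp
    linarith
  rcases le_total x (1 / 2) with h | h
  · linarith [key x (by linarith) h]
  · have h3 := key (1 - x) (by linarith) (by linarith)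
    rw [show Real.pi * (1 - x) = Real.pi - Real.pi * x by ring, Real.sin_pi_sub] at h3
    linarith

/-- The sublevel set yields points separated in `x`, whereas the interpolation nodes are `cos πx`.
Away from the endpoints the cosine does not collapse distances: in the product formula for the
difference, both sines are bounded below by Jordan's inequality. -/
theorem le_abs_cos_sub_cos {η x y : ℝ} (h0 : 0 ≤ η) (hx : x ∈ Icc η (1 - η))
    (hy : y ∈ Icc η (1 - η)) :
    4 * η * |x - y| ≤ |Real.cos (Real.pi * x) - Real.cos (Real.pi * y)| := by
  wlog h : y ≤ x generalizing x y
  · have := this hy hx (not_le.1 h).le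
    rwa [abs_sub_comm, abs_sub_comm (Real.cos _)] at this
  rw [Real.cos_sub_cos, abs_mul, abs_mul, abs_neg, abs_two]
  have h1 := two_mul_le_sin_pi_mul (η := η) (x := (x + y) / 2) (by linarith [hx.1, hy.1])
    (by linarith [hx.2, hy.2]) h0
  have h2 := two_mul_le_sin_pi_mul (η := (x - y) / 2) (x := (x - y) / 2) le_rfl
    (by linarith [hx.2, hy.1, hx.1, hy.2]) (by linarith)
  rw [show (Real.pi * x + Real.pi * y) / 2 = Real.pi * ((x + y) / 2) by ring,
    show (Real.pi * x - Real.pi * y) / 2 = Real.pi * ((x - y) / 2) by ring,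
    abs_of_nonneg (by linarith : (0 : ℝ) ≤ x - y)]
  have h3 := h1.trans (le_abs_self _)
  have h4 := h2.trans (le_abs_self _)
  have h5 : (2 * η) * (2 * ((x - y) / 2)) ≤ |Real.sin (Real.pi * ((x + y) / 2))|
      * |Real.sin (Real.pi * ((x - y) / 2))| :=
    mul_le_mul h3 h4 (by linarith) (abs_nonneg _)
  linarith

/-- The Chebyshev polynomials of the second kind satisfy `sin((k+1)θ) = U_k(cos θ) sin θ`. -/
theorem exists_polynomial_sineSum (N : ℕ) (b : ℕ → ℝ) :
    ∃ Q : Polynomial ℝ, Q.degree < N ∧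
      ∀ x, sineSum N b x = Q.eval (Real.cos (Real.pi * x)) * Real.sin (Real.pi * x) := by
  refine ⟨∑ k ∈ Finset.range N, Polynomial.C (b k * √2) * Polynomial.Chebyshev.U ℝ k, ?_, ?_⟩
  · refine Polynomial.degree_lt_iff_coeff_zero _ _ |>.2 ?_
    intro m hm
    rw [Polynomial.finsetSum_coeff]
    apply Finset.sum_eq_zero
    intro k hk
    rw [Polynomial.coeff_C_mul, Polynomial.coeff_eq_zero_of_natDegree_lt, mul_zero]
    rw [Polynomial.Chebyshev.natDegree_U_natCast]
    exact (Finset.mem_range.1 hk).trans_le hm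
  · intro x
    rw [sineSum, Polynomial.eval_finsetSum, Finset.sum_mul]
    apply Finset.sum_congr rfl
    intro k _
    rw [Polynomial.eval_mul, Polynomial.eval_C, mul_assoc, Polynomial.Chebyshev.U_real_cos,
      sineFn, freq]
    push_cast
    ring_nf

/-- If the sublevel set of a sine polynomial inside `[η, 1 - η]` has measure at least `κ`, the
polynomial is bounded on the whole line. -/
theorem abs_sineSum_le {n : ℕ} {b : ℕ → ℝ} {η κ B : ℝ} (hη : 0 < η) (hκ : 0 < κ) (hB : 0 ≤ B)
    (h : ENNReal.ofReal κ ≤ volume {x | x ∈ Icc η (1 - η) ∧ |sineSum (n + 1) b x| ≤ B}) (x : ℝ) :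
    |sineSum (n + 1) b x|
      ≤ (n + 1) * (B / (2 * η) * (((n + 1) / (η * κ)) ^ n / n.factorial)) := by
  obtain ⟨Q, hQ, hQe⟩ := exists_polynomial_sineSum (n + 1) b
  -- With this spacing `n d < κ`, so `n + 1` points fit in the sublevel set, as many as a polynomial
  -- of degree at most `n` needs.
  set d : ℝ := κ / (n + 1) with hd
  have hd0 : 0 < d := by positivity
  have hlt : (n : ℝ) * d < κ := by
    rw [hd, mul_div_assoc', div_lt_iff₀ (by positivity)]; linarith
  obtain ⟨z, hz1, hz2⟩ := exists_separated_points hd0 n _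
    (bddBelow_Icc.mono (fun x hx => hx.1))
    (((ENNReal.ofReal_lt_ofReal_iff hκ).2 hlt).trans_le h)
  have hbound := abs_eval_le_of_separated (n := n) (Q := Q) hQ (s := fun i => Real.cos (Real.pi * z i))
    -- The bound on `Q` loses the factor `2η`, a lower bound for `sin πx` on `[η, 1 - η]`.
    (c := 4 * η * d) (B := B / (2 * η)) (by positivity) (by positivity)
    (fun i _ => Real.abs_cos_le_one _)
    (fun i hi j hj => by
      refine le_trans ?_ (le_abs_cos_sub_cos hη.le (hz1 j hj).1 (hz1 i hi).1)
      rw [mul_assoc, mul_comm d]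
      exact mul_le_mul_of_nonneg_left (separated_le_abs_sub hz2 hi hj) (by positivity))
    (fun i hi => by
      have h1 := (hz1 i hi).2
      rw [hQe, abs_mul] at h1
      have h2 := two_mul_le_sin_pi_mul (hz1 i hi).1.1 (hz1 i hi).1.2 hη.le
      rw [le_div_iff₀ (by positivity)]
      refine le_trans ?_ h1
      exact mul_le_mul_of_nonneg_left (h2.trans (le_abs_self _)) (abs_nonneg _))
    (t := Real.cos (Real.pi * x)) (Real.abs_cos_le_one _)
  have e : 4 / (4 * η * d) = (n + 1) / (η * κ) := by rw [hd]; field_simp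
  rw [e] at hbound
  rw [hQe, abs_mul]
  refine le_trans ?_ hbound
  exact mul_le_of_le_one_right (abs_nonneg _) (Real.abs_sin_le_one _)

/-- The spectral inequality of Lebeau and Robbiano for the Dirichlet Laplacian on `(0,1)` and a
measurable observation set. -/
theorem spectral_inequality {ω : Set ℝ} (hω_sub : ω ⊆ Ioo 0 1)
    (hω_pos : 0 < volume ω) :
    ∃ A a : ℝ, 1 ≤ A ∧ 0 < a ∧ ∀ (N : ℕ) (b : ℕ → ℝ),
      ∑ k ∈ Finset.range N, b k ^ 2 ≤ A * Real.exp (2 * a * N) * ∫ x in ω, sineSum N b x ^ 2 := by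
  have hω_le : volume ω ≤ 1 := by simpa using measure_mono (μ := volume) hω_sub
  have hω_fin : volume ω ≠ ⊤ := ne_top_of_le_ne_top ENNReal.one_ne_top hω_le
  set m : ℝ := (volume ω).toReal with hm
  have hm0 : 0 < m := ENNReal.toReal_pos hω_pos.ne' hω_fin
  have hm1 : m ≤ 1 := by
    have := ENNReal.toReal_mono ENNReal.one_ne_top hω_le
    simpa using this
  have hvol : volume ω = ENNReal.ofReal m := (ENNReal.ofReal_toReal hω_fin).symm
  -- Measure budget: the two edges of width `η` cost `m / 4` and the set where the sum is large
  -- costs another `m / 4`, which leaves `m / 2` for interpolation.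
  set η : ℝ := m / 8 with hη
  have hη0 : 0 < η := by positivity
  set r : ℝ := 1 / (η * (m / 2)) with hr
  have hr1 : 1 ≤ r := by
    rw [hr, le_div_iff₀ (by positivity), hη]; nlinarith
  -- The first constant is the square of `B / (2η)` divided by `M`. In the second, `log r` comes
  -- from `r ^ n`, and the 2 from bounding both `n + 1` and `(n + 1)^n / n!` by `exp (n + 1)`.
  refine ⟨1 / (m * η ^ 2), 2 + Real.log r, ?_, by have := Real.log_nonneg hr1; linarith, ?_⟩
  · rw [le_div_iff₀ (by positivity), one_mul, hη]
    have : (m / 8) ^ 2 ≤ 1 := by nlinarith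
    nlinarith
  intro N b
  rcases N with _ | n
  · simp [sineSum]
  set S := ∫ x in ω, sineSum (n + 1) b x ^ 2 with hS
  have hcont := continuous_sineSum (n + 1) b
  have hint : IntegrableOn (fun x => sineSum (n + 1) b x ^ 2) ω := by
    have h1 : IntegrableOn (fun x => sineSum (n + 1) b x ^ 2) (Icc 0 1) :=
      (hcont.pow 2).integrableOn_Icc
    exact h1.mono_set (hω_sub.trans Ioo_subset_Icc_self)
  have hS0 : 0 ≤ S := integral_nonneg fun x => sq_nonneg _
  -- Working with `M > S` keeps the Chebyshev threshold positive even if `S` vanishes; `M` is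
  -- brought down to `S` at the end.
  have key : ∀ M, S < M → ∑ k ∈ Finset.range (n + 1), b k ^ 2
      ≤ 1 / (m * η ^ 2) * Real.exp (2 * (2 + Real.log r) * (n + 1 : ℕ)) * M := by
    intro M hM
    have hM0 : 0 < M := hS0.trans_lt hM
    have hcheb : volume (ω ∩ {x | 4 * M / m ≤ sineSum (n + 1) b x ^ 2}) ≤ ENNReal.ofReal (m / 4) := by
      have h1 := mul_meas_ge_le_integral_of_nonneg (μ := volume.restrict ω)
        (f := fun x => sineSum (n + 1) b x ^ 2) (Filter.Eventually.of_forall fun x => sq_nonneg _)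
        hint (4 * M / m)
      rw [measureReal_def, Measure.restrict_apply
        (show MeasurableSet {x | 4 * M / m ≤ sineSum (n + 1) b x ^ 2} from
          measurableSet_le measurable_const (hcont.pow 2).measurable), inter_comm] at h1
      have hf : volume (ω ∩ {x | 4 * M / m ≤ sineSum (n + 1) b x ^ 2}) ≠ ⊤ :=
        ne_top_of_le_ne_top hω_fin (measure_mono inter_subset_left)
      rw [← ENNReal.ofReal_toReal hf]
      apply ENNReal.ofReal_le_ofReal
      have h2 : 4 * M / m * (volume (ω ∩ {x | 4 * M / m ≤ sineSum (n + 1) b x ^ 2})).toReal ≤ M :=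
        h1.trans hM.le
      rw [div_mul_eq_mul_div, div_le_iff₀ hm0] at h2
      nlinarith
    set B := √(4 * M / m) with hB
    have hlarge : ENNReal.ofReal (m / 2)
        ≤ volume {x | x ∈ Icc η (1 - η) ∧ |sineSum (n + 1) b x| ≤ B} := by
      have hsub : ω ⊆ {x | x ∈ Icc η (1 - η) ∧ |sineSum (n + 1) b x| ≤ B} ∪
          ((ω ∩ {x | 4 * M / m ≤ sineSum (n + 1) b x ^ 2}) ∪ (Ioo 0 η ∪ Ioo (1 - η) 1)) := by
        intro x hx
        by_cases h1 : η ≤ x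
        · by_cases h2 : x ≤ 1 - η
          · by_cases h3 : 4 * M / m ≤ sineSum (n + 1) b x ^ 2
            · exact Or.inr (Or.inl ⟨hx, h3⟩)
            · exact Or.inl ⟨⟨h1, h2⟩, Real.abs_le_sqrt (not_le.1 h3).le⟩
          · exact Or.inr (Or.inr (Or.inr ⟨not_le.1 h2, (hω_sub hx).2⟩))
        · exact Or.inr (Or.inr (Or.inl ⟨(hω_sub hx).1, not_le.1 h1⟩))
      have h1 : ENNReal.ofReal m ≤
          volume {x | x ∈ Icc η (1 - η) ∧ |sineSum (n + 1) b x| ≤ B} + ENNReal.ofReal (m / 2) := by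
        rw [← hvol]
        calc volume ω ≤ _ := measure_mono hsub
          _ ≤ _ := measure_union_le _ _
          _ ≤ volume {x | x ∈ Icc η (1 - η) ∧ |sineSum (n + 1) b x| ≤ B} +
              (ENNReal.ofReal (m / 4) + (ENNReal.ofReal η + ENNReal.ofReal η)) := by
            gcongr
            refine (measure_union_le _ _).trans ?_
            gcongr
            refine (measure_union_le _ _).trans ?_
            rw [Real.volume_Ioo, Real.volume_Ioo]
            gcongr <;> linarith
          _ = _ := by
            rw [← ENNReal.ofReal_add hη0.le hη0.le, ← ENNReal.ofReal_add (by positivity)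
              (by positivity)]
            congr 2; rw [hη]; ring
      have h2 : ENNReal.ofReal m = ENNReal.ofReal (m / 2) + ENNReal.ofReal (m / 2) := by
        rw [← ENNReal.ofReal_add (by positivity) (by positivity), add_halves]
      rw [h2] at h1
      exact ENNReal.le_of_add_le_add_right ENNReal.ofReal_ne_top h1
    have hsup := abs_sineSum_le hη0 (by positivity) (Real.sqrt_nonneg _) hlarge
    have hexp : ∀ x, |sineSum (n + 1) b x|
        ≤ B / (2 * η) * Real.exp ((2 + Real.log r) * (n + 1 : ℕ)) := by
      intro x
      refine (hsup x).trans ?_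
      have e1 : ((n + 1 : ℝ) / (η * (m / 2))) ^ n / n.factorial
          = r ^ n * ((n + 1 : ℝ) ^ n / n.factorial) := by
        rw [← one_div_mul_eq_div (η * (m / 2)) ((n : ℝ) + 1), ← hr, mul_pow, mul_div_assoc]
      have e2 : (n + 1 : ℝ) ^ n / n.factorial ≤ Real.exp (n + 1) :=
        Real.pow_div_factorial_le_exp _ (by positivity) n
      have e3 : (n + 1 : ℝ) ≤ Real.exp (n + 1) := by
        have := Real.add_one_le_exp ((n : ℝ) + 1); linarith
      have e4 : r ^ n ≤ Real.exp (Real.log r * (n + 1)) := by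
        rw [Real.exp_mul, Real.exp_log (by linarith)]
        have : r ^ n ≤ r ^ (n + 1) := pow_le_pow_right₀ hr1 (by omega)
        exact_mod_cast this
      rw [e1]
      calc (n + 1 : ℝ) * (B / (2 * η) * (r ^ n * ((n + 1 : ℝ) ^ n / n.factorial)))
          ≤ Real.exp (n + 1) * (B / (2 * η) * (Real.exp (Real.log r * (n + 1)) * Real.exp (n + 1))) := by
            gcongr
        _ = B / (2 * η) * (Real.exp (n + 1) * Real.exp (Real.log r * (n + 1)) * Real.exp (n + 1)) := by
            ring
        _ = _ := by
            rw [← Real.exp_add, ← Real.exp_add]; congr 2; push_cast; ring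
    rw [← integral_sineSum_sq]
    have hle : ∫ x in Ioo (0 : ℝ) 1, sineSum (n + 1) b x ^ 2 ≤ ∫ x in Ioo (0 : ℝ) 1,
        (B / (2 * η) * Real.exp ((2 + Real.log r) * (n + 1 : ℕ))) ^ 2 := by
      apply integral_mono
      · exact (hcont.pow 2).integrableOn_Icc.mono_set Ioo_subset_Icc_self
      · exact integrable_const _
      · intro x
        exact sq_le_sq.2 ((hexp x).trans (le_abs_self _))
    refine hle.trans (le_of_eq ?_)
    simp only [integral_const, MeasurableSet.univ, measureReal_restrict_apply, univ_inter,
      Real.volume_real_Ioo, smul_eq_mul]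
    rw [mul_pow, ← Real.exp_nat_mul, div_pow, hB, Real.sq_sqrt (by positivity)]
    rw [show ((2 : ℕ) : ℝ) * ((2 + Real.log r) * (n + 1 : ℕ))
      = 2 * (2 + Real.log r) * (n + 1 : ℕ) by push_cast; ring]
    field_simp
    norm_num
  refine le_of_forall_gt_imp_ge_of_dense fun y hy => ?_
  have hpos : 0 < 1 / (m * η ^ 2) * Real.exp (2 * (2 + Real.log r) * (n + 1 : ℕ)) := by positivity
  have := key (y / (1 / (m * η ^ 2) * Real.exp (2 * (2 + Real.log r) * (n + 1 : ℕ))))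
    (by rwa [lt_div_iff₀' hpos])
  rwa [mul_div_cancel₀ _ hpos.ne'] at this

/-! ### Observability of the heat flow. -/

/-- Sine polynomials with a given finite set of frequencies. -/
noncomputable def sineSumOn (S : Finset ℕ) (b : ℕ → ℝ) (x : ℝ) : ℝ :=
  ∑ k ∈ S, b k * sineFn k x

theorem continuous_sineSumOn (S : Finset ℕ) (b : ℕ → ℝ) : Continuous (sineSumOn S b) :=
  continuous_finsetSum _ fun k _ => continuous_const.mul (continuous_sineFn k)

theorem sineSumOn_eq {S : Finset ℕ} {n : ℕ} (h : S ⊆ Finset.range n) (b : ℕ → ℝ) :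
    sineSumOn S b = sineSum n (fun k => if k ∈ S then b k else 0) := by
  ext x
  simp only [sineSumOn, sineSum, ite_mul, zero_mul]
  rw [← Finset.sum_filter, Finset.filter_mem_eq_inter, Finset.inter_eq_right.2 h]

theorem sum_sq_eq {S : Finset ℕ} {n : ℕ} (h : S ⊆ Finset.range n) (b : ℕ → ℝ) :
    ∑ k ∈ S, b k ^ 2 = ∑ k ∈ Finset.range n, (if k ∈ S then b k else 0) ^ 2 := by
  simp only [ite_pow, ne_eq, OfNat.ofNat_ne_zero, not_false_eq_true, zero_pow]
  rw [← Finset.sum_filter, Finset.filter_mem_eq_inter, Finset.inter_eq_right.2 h]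

theorem integral_sineSumOn_sq (S : Finset ℕ) (b : ℕ → ℝ) :
    ∫ x in Ioo (0 : ℝ) 1, sineSumOn S b x ^ 2 = ∑ k ∈ S, b k ^ 2 := by
  obtain ⟨n, hn⟩ := S.exists_nat_subset_range
  rw [sineSumOn_eq hn, sum_sq_eq hn, integral_sineSum_sq]

theorem integrableOn_unitInterval {ω : Set ℝ} (hω_sub : ω ⊆ Ioo 0 1) {f : ℝ → ℝ}
    (hf : Continuous f) : IntegrableOn f ω :=
  hf.integrableOn_Icc.mono_set (hω_sub.trans Ioo_subset_Icc_self)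

theorem setIntegral_sineSumOn_sq_le {ω : Set ℝ} (hω_sub : ω ⊆ Ioo 0 1) (S : Finset ℕ)
    (b : ℕ → ℝ) : ∫ x in ω, sineSumOn S b x ^ 2 ≤ ∑ k ∈ S, b k ^ 2 := by
  rw [← integral_sineSumOn_sq]
  exact setIntegral_mono_set (integrableOn_unitInterval subset_rfl
    ((continuous_sineSumOn S b).pow 2)) (Filter.Eventually.of_forall fun _ => sq_nonneg _)
    hω_sub.eventuallyLE

/-- The spectral inequality sees only the low modes. On `ω` their sum is the whole minus the high
modes, so its square is at most twice the sum of the two squares; the high modes survive as an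
error, later killed by dissipation. -/
theorem sum_sq_le_low_high {ω : Set ℝ} (hω_sub : ω ⊆ Ioo 0 1) {n : ℕ} {K : ℝ} (hK : 0 ≤ K)
    (h : ∀ b : ℕ → ℝ, ∑ k ∈ Finset.range n, b k ^ 2 ≤ K * ∫ x in ω, sineSum n b x ^ 2)
    (S : Finset ℕ) (b : ℕ → ℝ) :
    ∑ k ∈ S, b k ^ 2 ≤ 2 * K * (∫ x in ω, sineSumOn S b x ^ 2)
      + (2 * K + 1) * ∑ k ∈ S with ¬ k < n, b k ^ 2 := by
  have hl : (S.filter (· < n)) ⊆ Finset.range n := by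
    intro k hk
    rw [Finset.mem_range]
    exact (Finset.mem_filter.1 hk).2
  have h1 := h (fun k => if k ∈ S.filter (· < n) then b k else 0)
  rw [← sineSumOn_eq hl, ← sum_sq_eq hl] at h1
  have hsplit : ∀ x, sineSumOn S b x
      = sineSumOn (S.filter (· < n)) b x + sineSumOn (S.filter (¬ · < n)) b x := fun x =>
    (Finset.sum_filter_add_sum_filter_not S (· < n) _).symm
  have hi : ∀ S', Integrable (fun x => sineSumOn S' b x ^ 2) (volume.restrict ω) := fun S' =>
    integrableOn_unitInterval hω_sub ((continuous_sineSumOn _ b).pow 2)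
  have h2 : ∫ x in ω, sineSumOn (S.filter (· < n)) b x ^ 2
      ≤ ∫ x in ω, (2 * sineSumOn S b x ^ 2 + 2 * sineSumOn (S.filter (¬ · < n)) b x ^ 2) := by
    apply integral_mono
    · exact hi _
    · exact ((hi _).const_mul 2).add ((hi _).const_mul 2)
    · intro x
      simp only
      rw [eq_sub_of_add_eq (hsplit x).symm]
      nlinarith [sq_nonneg (sineSumOn S b x + sineSumOn (S.filter (¬ · < n)) b x)]
  rw [integral_add ((hi _).const_mul 2) ((hi _).const_mul 2), integral_const_mul,
    integral_const_mul] at h2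
  have h3 := setIntegral_sineSumOn_sq_le hω_sub (S.filter (¬ · < n)) b
  have h4 := Finset.sum_filter_add_sum_filter_not S (· < n) (fun k => b k ^ 2)
  have h5 := mul_le_mul_of_nonneg_left h2 hK
  have h6 := mul_le_mul_of_nonneg_left h3 hK
  linarith

/-- The coefficients of a finite sum of eigenmodes evolving under the heat equation. -/
noncomputable def evol (b : ℕ → ℝ) (t : ℝ) (k : ℕ) : ℝ := Real.exp (-(eigval k * t)) * b k

/-- The energy of a finite sum of eigenmodes. -/
noncomputable def energy (S : Finset ℕ) (b : ℕ → ℝ) (t : ℝ) : ℝ := ∑ k ∈ S, evol b t k ^ 2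

/-- The energy in `ω` of a finite sum of eigenmodes. -/
noncomputable def localEnergy (ω : Set ℝ) (S : Finset ℕ) (b : ℕ → ℝ) (t : ℝ) : ℝ :=
  ∫ x in ω, sineSumOn S (evol b t) x ^ 2

theorem energy_nonneg (S : Finset ℕ) (b : ℕ → ℝ) (t : ℝ) : 0 ≤ energy S b t :=
  Finset.sum_nonneg fun _ _ => sq_nonneg _

theorem localEnergy_nonneg (ω : Set ℝ) (S : Finset ℕ) (b : ℕ → ℝ) (t : ℝ) :
    0 ≤ localEnergy ω S b t :=
  integral_nonneg fun _ => sq_nonneg _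

theorem evol_sq (b : ℕ → ℝ) (s t : ℝ) (k : ℕ) :
    evol b t k ^ 2 = Real.exp (-(2 * eigval k * (t - s))) * evol b s k ^ 2 := by
  simp only [evol, mul_pow]
  rw [← mul_assoc, ← Real.exp_nat_mul, ← Real.exp_nat_mul, ← Real.exp_add]
  congr 2
  push_cast; ring

theorem sum_evol_sq_le {S S' : Finset ℕ} (hS : S ⊆ S') {b : ℕ → ℝ} {s t l : ℝ} (hst : s ≤ t)
    (hl : ∀ k ∈ S, l ≤ eigval k) :
    ∑ k ∈ S, evol b t k ^ 2 ≤ Real.exp (-(2 * l * (t - s))) * energy S' b s := by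
  rw [energy, Finset.mul_sum]
  calc _ ≤ ∑ k ∈ S, Real.exp (-(2 * l * (t - s))) * evol b s k ^ 2 := by
        apply Finset.sum_le_sum
        intro k hk
        rw [evol_sq b s t k]
        have := hl k hk
        have h2 : 0 ≤ t - s := by linarith
        gcongr
    _ ≤ _ := Finset.sum_le_sum_of_subset_of_nonneg hS fun k _ _ => by positivity

theorem energy_antitone (S : Finset ℕ) (b : ℕ → ℝ) : Antitone (energy S b) := by
  intro s t hst
  have := sum_evol_sq_le (subset_refl S) (b := b) hst (l := 0) fun k _ => (eigval_pos k).le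
  simpa [energy] using this

theorem continuous_localEnergy {ω : Set ℝ} (hω_sub : ω ⊆ Ioo 0 1) (S : Finset ℕ) (b : ℕ → ℝ) :
    Continuous (localEnergy ω S b) := by
  have h : localEnergy ω S b = fun t => ∑ i ∈ S, ∑ j ∈ S,
      evol b t i * evol b t j * ∫ x in ω, sineFn i x * sineFn j x := by
    ext t
    have e : ∀ x, sineSumOn S (evol b t) x ^ 2
        = ∑ i ∈ S, ∑ j ∈ S, evol b t i * evol b t j * (sineFn i x * sineFn j x) := by
      intro x
      rw [pow_two, sineSumOn, Finset.sum_mul_sum]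
      refine Finset.sum_congr rfl fun i _ => Finset.sum_congr rfl fun j _ => by ring
    have hi : ∀ i j, Integrable (fun x => evol b t i * evol b t j * (sineFn i x * sineFn j x))
        (volume.restrict ω) := fun i j => integrableOn_unitInterval hω_sub
          (((continuous_sineFn i).mul (continuous_sineFn j)).const_mul _)
    rw [localEnergy]
    simp_rw [e]
    rw [integral_finsetSum _ fun i _ => integrable_finsetSum _ fun j _ => hi i j]
    refine Finset.sum_congr rfl fun i _ => ?_
    rw [integral_finsetSum _ fun j _ => hi i j]
    exact Finset.sum_congr rfl fun j _ => integral_const_mul _ _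
  rw [h]
  unfold evol
  fun_prop

section Observability

variable {ω : Set ℝ} {A a : ℝ}

/-- The weight in the approximate observability estimates. -/
noncomputable def obsWeight (A a δ : ℝ) : ℝ :=
  δ * Real.exp (-(2 * a * (4 * a + 6 * A) / δ)) / (6 * A)

theorem obsWeight_le (hA : 1 ≤ A) (ha : 0 < a) {δ : ℝ} (hδ : 0 < δ) : obsWeight A a δ ≤ δ := by
  unfold obsWeight
  rw [div_le_iff₀ (by positivity)]
  have h1 : Real.exp (-(2 * a * (4 * a + 6 * A) / δ)) ≤ 1 := by
    rw [Real.exp_le_one_iff, neg_nonpos]; positivity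
  nlinarith

/-- On the second half of the interval the high modes have already decayed, so the low modes can be
observed up to a small error. The weights are designed so that the error weight at length `δ` is the
main weight at length `δ / 2`, which makes the estimates telescope. -/
theorem approximate_observability (hω_sub : ω ⊆ Ioo 0 1) (hA : 1 ≤ A) (ha : 0 < a)
    (h : ∀ (N : ℕ) (b : ℕ → ℝ), ∑ k ∈ Finset.range N, b k ^ 2
      ≤ A * Real.exp (2 * a * N) * ∫ x in ω, sineSum N b x ^ 2)
    (S : Finset ℕ) (b : ℕ → ℝ) {s t : ℝ} (hst : s < t) (hst1 : t - s ≤ 1) :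
    obsWeight A a (t - s) * energy S b t
      ≤ (∫ τ in s..t, localEnergy ω S b τ) + obsWeight A a ((t - s) / 2) * energy S b s := by
  set δ := t - s with hδ
  have hδ0 : 0 < δ := by linarith
  -- The dissipation `exp(-β²/δ)` has to beat the spectral cost at half scale, `exp(-4aβ/δ) / (6A)`.
  -- With this choice `β² - 4aβ = 6Aβ ≥ 6A`, which suffices since `δ ≤ 1`.
  set β := 4 * a + 6 * A with hβ
  have hβ1 : 1 ≤ β := by linarith
  set n := ⌊β / δ⌋₊ with hn
  have hn1 : (n : ℝ) ≤ β / δ := Nat.floor_le (by positivity)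
  have hn2 : β / δ < n + 1 := Nat.lt_floor_add_one _
  set K := A * Real.exp (2 * a * n) with hK
  have hK1 : 1 ≤ K := by
    have : 1 ≤ Real.exp (2 * a * n) := Real.one_le_exp (by positivity)
    nlinarith
  have hK2 : K ≤ A * Real.exp (2 * a * β / δ) := by
    rw [hK, mul_div_assoc]; gcongr
  have hKpos : 0 < K := by linarith
  -- The frequency of index `n` is `(n + 1) π`, so it exceeds `β / δ` although `n` is rounded down.
  have hl : β ^ 2 / δ ≤ eigval n * δ := by
    have h1 : β / δ ≤ freq n := by
      unfold freq
      have : 1 ≤ Real.pi := by linarith [Real.pi_gt_three]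
      nlinarith
    have h2 : (β / δ) ^ 2 ≤ eigval n := by
      unfold eigval; gcongr
    have h3 : β ^ 2 / δ = (β / δ) ^ 2 * δ := by field_simp
    rw [h3]; gcongr
  have hE0 := energy_nonneg S b s
  -- pointwise in the second half of the interval
  have hpt : ∀ τ ∈ Icc (t - δ / 2) t,
      energy S b t ≤ 3 * K * (localEnergy ω S b τ + Real.exp (-(β ^ 2 / δ)) * energy S b s) := by
    intro τ hτ
    have h1 := energy_antitone S b hτ.2
    have h2 : energy S b τ ≤ 2 * K * localEnergy ω S b τ
        + (2 * K + 1) * ∑ k ∈ S with ¬ k < n, evol b τ k ^ 2 :=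
      sum_sq_le_low_high hω_sub hKpos.le (h n) S (evol b τ)
    have h3 := sum_evol_sq_le (S := S.filter (¬ · < n)) (Finset.filter_subset _ S) (b := b)
      (s := s) (t := τ) (by linarith [hτ.1]) (l := eigval n) fun k hk =>
        eigval_mono (not_lt.1 (Finset.mem_filter.1 hk).2)
    have h4 : Real.exp (-(2 * eigval n * (τ - s))) ≤ Real.exp (-(β ^ 2 / δ)) := by
      apply Real.exp_le_exp.2
      have := eigval_pos n
      have : δ ≤ 2 * (τ - s) := by linarith [hτ.1]
      nlinarith
    have h5 := h3.trans (mul_le_mul_of_nonneg_right h4 hE0)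
    have h6 : (2 * K + 1) * ∑ k ∈ S with ¬ k < n, evol b τ k ^ 2
        ≤ 3 * K * (Real.exp (-(β ^ 2 / δ)) * energy S b s) := by
      refine mul_le_mul (by linarith) h5 (Finset.sum_nonneg fun _ _ => sq_nonneg _) (by linarith)
    have h7 := localEnergy_nonneg ω S b τ
    have h8 : 2 * K * localEnergy ω S b τ ≤ 3 * K * localEnergy ω S b τ := by nlinarith
    linarith
  have hcont := continuous_localEnergy hω_sub S b
  have hint : δ / 2 * energy S b t ≤ 3 * K * ((∫ τ in s..t, localEnergy ω S b τ)
      + δ / 2 * (Real.exp (-(β ^ 2 / δ)) * energy S b s)) := by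
    have h1 : ∫ _ in (t - δ / 2)..t, energy S b t ≤ ∫ τ in (t - δ / 2)..t,
        3 * K * (localEnergy ω S b τ + Real.exp (-(β ^ 2 / δ)) * energy S b s) := by
      apply intervalIntegral.integral_mono_on (by linarith)
      · simp
      · exact ((hcont.add continuous_const).const_mul _).intervalIntegrable _ _
      · exact hpt
    rw [intervalIntegral.integral_const_mul, intervalIntegral.integral_add
      (hcont.intervalIntegrable _ _) (by simp), intervalIntegral.integral_const,
      intervalIntegral.integral_const, smul_eq_mul, smul_eq_mul,
      show t - (t - δ / 2) = δ / 2 by ring] at h1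
    have h2 : ∫ τ in (t - δ / 2)..t, localEnergy ω S b τ ≤ ∫ τ in s..t, localEnergy ω S b τ :=
      intervalIntegral.integral_mono_interval (by linarith) (by linarith) le_rfl
        (Filter.Eventually.of_forall fun _ => localEnergy_nonneg _ _ _ _)
        (hcont.intervalIntegrable _ _)
    refine h1.trans ?_
    gcongr
  have hw1 : obsWeight A a δ ≤ δ / 2 / (3 * K) := by
    have h1 : δ / 2 / (3 * (A * Real.exp (2 * a * β / δ))) ≤ δ / 2 / (3 * K) := by gcongr
    refine le_trans (le_of_eq ?_) h1
    rw [obsWeight, ← hβ, Real.exp_neg]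
    field_simp
    norm_num
  have hw2 : δ / 2 * Real.exp (-(β ^ 2 / δ)) ≤ obsWeight A a (δ / 2) := by
    rw [obsWeight, ← hβ, le_div_iff₀ (by positivity)]
    have h1 : 6 * A ≤ Real.exp ((β ^ 2 - 4 * a * β) / δ) := by
      have h2 : 6 * A ≤ β ^ 2 - 4 * a * β := by
        have : β ^ 2 - 4 * a * β = β * (6 * A) := by rw [hβ]; ring
        rw [this]; nlinarith
      have h3 : β ^ 2 - 4 * a * β ≤ (β ^ 2 - 4 * a * β) / δ := by
        rw [le_div_iff₀ hδ0]; nlinarith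
      have h4 := Real.add_one_le_exp ((β ^ 2 - 4 * a * β) / δ)
      linarith
    have h5 : Real.exp (-(2 * a * β / (δ / 2)))
        = Real.exp (-(β ^ 2 / δ)) * Real.exp ((β ^ 2 - 4 * a * β) / δ) := by
      rw [← Real.exp_add]; congr 1; field_simp; ring
    rw [h5, mul_assoc]
    gcongr
  have h9 : obsWeight A a δ * energy S b t ≤ δ / 2 / (3 * K) * energy S b t :=
    mul_le_mul_of_nonneg_right hw1 (energy_nonneg _ _ _)
  have h10 : δ / 2 / (3 * K) * energy S b t ≤ (∫ τ in s..t, localEnergy ω S b τ)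
      + δ / 2 * (Real.exp (-(β ^ 2 / δ)) * energy S b s) := by
    rw [div_mul_eq_mul_div, div_le_iff₀ (by positivity)]
    linarith
  have h11 := mul_le_mul_of_nonneg_right hw2 hE0
  linarith

/-- The interval from `T / 2^(j+1)` to `T / 2^j` has length `T / 2^(j+1)`, so the error weight of
each step is exactly the main weight of the next one closer to time zero. -/
theorem observability_telescope (hω_sub : ω ⊆ Ioo 0 1) (hA : 1 ≤ A) (ha : 0 < a)
    (h : ∀ (N : ℕ) (b : ℕ → ℝ), ∑ k ∈ Finset.range N, b k ^ 2
      ≤ A * Real.exp (2 * a * N) * ∫ x in ω, sineSum N b x ^ 2)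
    (S : Finset ℕ) (b : ℕ → ℝ) {T : ℝ} (hT : 0 < T) (hT1 : T ≤ 1) (j : ℕ) :
    obsWeight A a (T / 2) * energy S b T ≤ (∫ τ in (T / 2 ^ j)..T, localEnergy ω S b τ)
      + obsWeight A a (T / 2 ^ (j + 1)) * energy S b (T / 2 ^ j) := by
  induction j with
  | zero => simp
  | succ j ih =>
    have hcont := continuous_localEnergy hω_sub S b
    have hp : 0 < T / 2 ^ (j + 1) := by positivity
    have e : T / 2 ^ j = 2 * (T / 2 ^ (j + 1)) := by rw [pow_succ]; field_simp
    have e1 : T / 2 ^ j - T / 2 ^ (j + 1) = T / 2 ^ (j + 1) := by rw [e]; ring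
    have e2 : T / 2 ^ (j + 1) / 2 = T / 2 ^ (j + 1 + 1) := by rw [pow_succ _ (j + 1)]; field_simp
    have h1 := approximate_observability hω_sub hA ha h S b
      (s := T / 2 ^ (j + 1)) (t := T / 2 ^ j) (by linarith) (by
        rw [e1, div_le_one (by positivity)]
        exact hT1.trans (one_le_pow₀ (by norm_num)))
    rw [e1, e2] at h1
    rw [← intervalIntegral.integral_add_adjacent_intervals (b := T / 2 ^ j)
      (hcont.intervalIntegrable _ _) (hcont.intervalIntegrable _ _)]
    linarith

/-- Let `j → ∞` in the telescoped estimate: the remaining weight is at most `T / 2^(j+1)` while the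
energy stays below its initial value. -/
theorem observability_small_time (hω_sub : ω ⊆ Ioo 0 1) (hA : 1 ≤ A) (ha : 0 < a)
    (h : ∀ (N : ℕ) (b : ℕ → ℝ), ∑ k ∈ Finset.range N, b k ^ 2
      ≤ A * Real.exp (2 * a * N) * ∫ x in ω, sineSum N b x ^ 2)
    (S : Finset ℕ) (b : ℕ → ℝ) {T : ℝ} (hT : 0 < T) (hT1 : T ≤ 1) :
    obsWeight A a (T / 2) * energy S b T ≤ ∫ τ in (0 : ℝ)..T, localEnergy ω S b τ := by
  have hcont := continuous_localEnergy hω_sub S b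
  have hle : ∀ j : ℕ, obsWeight A a (T / 2) * energy S b T
      ≤ (∫ τ in (0 : ℝ)..T, localEnergy ω S b τ) + T / 2 * energy S b 0 * (1 / 2) ^ j := by
    intro j
    have h1 := observability_telescope hω_sub hA ha h S b hT hT1 j
    have hp : 0 < T / 2 ^ j := by positivity
    have hp1 : 0 < T / 2 ^ (j + 1) := by positivity
    have h2 : ∫ τ in (T / 2 ^ j)..T, localEnergy ω S b τ
        ≤ ∫ τ in (0 : ℝ)..T, localEnergy ω S b τ :=
      intervalIntegral.integral_mono_interval hp.le
        (div_le_self hT.le (one_le_pow₀ (by norm_num))) le_rfl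
        (Filter.Eventually.of_forall fun _ => localEnergy_nonneg _ _ _ _)
        (hcont.intervalIntegrable _ _)
    have h3 : obsWeight A a (T / 2 ^ (j + 1)) * energy S b (T / 2 ^ j)
        ≤ T / 2 ^ (j + 1) * energy S b 0 :=
      mul_le_mul (obsWeight_le hA ha hp1) (energy_antitone S b hp.le) (energy_nonneg _ _ _) hp1.le
    have e : T / 2 ^ (j + 1) * energy S b 0 = T / 2 * energy S b 0 * (1 / 2) ^ j := by
      rw [pow_succ, one_div, inv_pow]; field_simp
    linarith
  have hlim : Filter.Tendsto (fun j : ℕ => (∫ τ in (0 : ℝ)..T, localEnergy ω S b τ)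
      + T / 2 * energy S b 0 * (1 / 2) ^ j) Filter.atTop
      (nhds ((∫ τ in (0 : ℝ)..T, localEnergy ω S b τ) + T / 2 * energy S b 0 * 0)) :=
    ((tendsto_pow_atTop_nhds_zero_of_lt_one (by norm_num) (by norm_num)).const_mul _).const_add _
  rw [mul_zero, add_zero] at hlim
  exact ge_of_tendsto' hlim hle

end Observability

/-- Observability of the heat equation from `ω` for finite sums of eigenmodes. -/
theorem observability {ω : Set ℝ} (hω_sub : ω ⊆ Ioo 0 1)
    (hω_pos : 0 < volume ω) :
    ∃ C : ℝ, 0 < C ∧ ∀ T : ℝ, 0 < T → ∀ (S : Finset ℕ) (b : ℕ → ℝ),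
      energy S b T ≤ (C * Real.exp (C / T)) ^ 2 * ∫ τ in (0 : ℝ)..T, localEnergy ω S b τ := by
  obtain ⟨A, a, hA, ha, h⟩ := spectral_inequality hω_sub hω_pos
  set c := 4 * a * (4 * a + 6 * A) with hc
  have hc0 : 0 < c := by positivity
  -- The `+ 1` absorbs the factor `T⁻¹ ≤ exp(1/T)` of the weight. This `C` is large enough to serve
  -- both as prefactor and in the exponent.
  set C := 12 * A * Real.exp (c + 1) with hC
  have hE1 : c + 1 ≤ Real.exp (c + 1) := by linarith [Real.add_one_le_exp (c + 1)]
  have hC1 : 1 ≤ C := by nlinarith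
  have hC2 : c + 1 ≤ C := by nlinarith
  have hsmall : ∀ T, 0 < T → T ≤ 1 → ∀ (S : Finset ℕ) (b : ℕ → ℝ), energy S b T
      ≤ 12 * A * Real.exp ((c + 1) / T) * ∫ τ in (0 : ℝ)..T, localEnergy ω S b τ := by
    intro T hT hT1 S b
    have h1 := observability_small_time hω_sub hA ha h S b hT hT1
    have hG : 0 ≤ ∫ τ in (0 : ℝ)..T, localEnergy ω S b τ :=
      intervalIntegral.integral_nonneg hT.le fun _ _ => localEnergy_nonneg _ _ _ _
    have hw : obsWeight A a (T / 2) = T / (12 * A * Real.exp (c / T)) := by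
      rw [obsWeight, Real.exp_neg, show 2 * a * (4 * a + 6 * A) / (T / 2) = c / T by
        rw [hc]; field_simp; ring]
      field_simp; norm_num
    rw [hw, div_mul_eq_mul_div, div_le_iff₀ (by positivity)] at h1
    have h2 : T⁻¹ ≤ Real.exp (1 / T) := by
      have := Real.add_one_le_exp (1 / T)
      rw [one_div] at *; linarith
    have h3 : Real.exp ((c + 1) / T) = Real.exp (c / T) * Real.exp (1 / T) := by
      rw [← Real.exp_add]; congr 1; ring
    rw [h3]
    calc energy S b T = T⁻¹ * (T * energy S b T) := by field_simp
      _ ≤ T⁻¹ * ((∫ τ in (0 : ℝ)..T, localEnergy ω S b τ) * (12 * A * Real.exp (c / T))) := by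
          gcongr
      _ ≤ Real.exp (1 / T) * ((∫ τ in (0 : ℝ)..T, localEnergy ω S b τ)
          * (12 * A * Real.exp (c / T))) := by gcongr
      _ = _ := by ring
  refine ⟨C, by linarith, fun T hT S b => ?_⟩
  have hG : 0 ≤ ∫ τ in (0 : ℝ)..T, localEnergy ω S b τ :=
    intervalIntegral.integral_nonneg hT.le fun _ _ => localEnergy_nonneg _ _ _ _
  have hCC : C ≤ C ^ 2 := by nlinarith
  have hexp : Real.exp (C / T) ^ 2 = Real.exp (2 * C / T) := by
    rw [← Real.exp_nat_mul]; congr 1; push_cast; ring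
  rw [mul_pow, hexp]
  rcases le_total T 1 with hT1 | hT1
  · refine (hsmall T hT hT1 S b).trans (mul_le_mul_of_nonneg_right ?_ hG)
    have h1 : 12 * A ≤ C := by
      have : 1 ≤ Real.exp (c + 1) := by linarith
      nlinarith
    have h2 : 12 * A ≤ C ^ 2 := h1.trans hCC
    have h3 : c + 1 ≤ 2 * C := by linarith
    gcongr
  -- For long times it is enough to observe during `(0,1)`, since the energy decreases afterwards.
  · have h1 := hsmall 1 one_pos le_rfl S b
    rw [div_one] at h1
    have h2 : ∫ τ in (0 : ℝ)..1, localEnergy ω S b τ ≤ ∫ τ in (0 : ℝ)..T, localEnergy ω S b τ :=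
      intervalIntegral.integral_mono_interval le_rfl zero_le_one hT1
        (Filter.Eventually.of_forall fun _ => localEnergy_nonneg _ _ _ _)
        ((continuous_localEnergy hω_sub S b).intervalIntegrable _ _)
    refine (energy_antitone S b hT1).trans (h1.trans ?_)
    have h3 : 1 ≤ Real.exp (2 * C / T) := Real.one_le_exp (by positivity)
    have h4 : C ≤ C ^ 2 * Real.exp (2 * C / T) := by nlinarith [sq_nonneg C]
    exact mul_le_mul h4 h2 (intervalIntegral.integral_nonneg zero_le_one
      fun _ _ => localEnergy_nonneg _ _ _ _) (by positivity)

/-! ### Duality and the construction of the control. -/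

/-- A moment problem in a Hilbert space is solvable as soon as the dual estimate holds. -/
theorem exists_of_moment_bound {H : Type*} [NormedAddCommGroup H] [InnerProductSpace ℝ H]
    [CompleteSpace H] (ψ : ℕ → H) (m : ℕ → ℝ) {K : ℝ} (hK : 0 ≤ K)
    (h : ∀ b : ℕ →₀ ℝ, |Finsupp.linearCombination ℝ m b| ≤ K * ‖Finsupp.linearCombination ℝ ψ b‖) :
    ∃ u : H, ‖u‖ ≤ K ∧ ∀ k, inner ℝ (ψ k) u = m k := by
  set L := Finsupp.linearCombination ℝ ψ
  set M := Finsupp.linearCombination ℝ m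
  obtain ⟨g, hg⟩ := L.rangeRestrict.exists_rightInverse_of_surjective L.range_rangeRestrict
  have hgx : ∀ x : LinearMap.range L, L (g x) = x := fun x =>
    congrArg Subtype.val (LinearMap.congr_fun hg x)
  let f : LinearMap.range L →ₗ[ℝ] ℝ := M.comp g
  have hf : ∀ x, ‖f x‖ ≤ K * ‖x‖ := by
    intro x
    have := h (g x)
    rw [hgx x] at this
    exact this
  -- The value does not depend on the preimage selected by `g`: the assumed bound forces `M` to
  -- vanish on the kernel of `L`.
  have hfM : ∀ b, f (L.rangeRestrict b) = M b := by
    intro b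
    have h1 := h (g (L.rangeRestrict b) - b)
    have h3 : L (g (L.rangeRestrict b) - b) = 0 := by
      rw [map_sub, hgx]; exact sub_self _
    change |M _| ≤ K * ‖L _‖ at h1
    rw [h3, norm_zero, mul_zero, map_sub] at h1
    have h2 := abs_nonpos_iff.1 h1
    exact sub_eq_zero.1 h2
  -- Hahn–Banach extends the functional without increasing its norm; its Riesz representative is the
  -- solution.
  obtain ⟨G, hG1, hG2⟩ := exists_extension_norm_eq (LinearMap.range L) (f.mkContinuous K hf)
  refine ⟨(InnerProductSpace.toDual ℝ H).symm G, ?_, fun k => ?_⟩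
  · rw [LinearIsometryEquiv.norm_map, hG2]
    exact f.mkContinuous_norm_le hK hf
  · rw [real_inner_comm, InnerProductSpace.toDual_symm_apply]
    have h1 : ψ k = (L.rangeRestrict (Finsupp.single k 1) : H) := by simp [L]
    rw [h1, hG1]
    refine (hfM _).trans ?_
    simp [M]

variable {ω : Set ℝ} {T : ℝ}

/-- The measure on `(0,T) × ω`. -/
noncomputable abbrev ctrlMeasure (ω : Set ℝ) (T : ℝ) : Measure (ℝ × ℝ) :=
  (volume.restrict (Ioo (0 : ℝ) T)).prod (volume.restrict ω)

/-- The solutions `e^{-λ (T - t)} e(x)` of the adjoint equation. -/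
noncomputable def adjointFn (T : ℝ) (k : ℕ) (p : ℝ × ℝ) : ℝ :=
  Real.exp (-(eigval k * (T - p.1))) * sineFn k p.2

theorem isFiniteMeasure_restrict (hω_sub : ω ⊆ Ioo 0 1) : IsFiniteMeasure (volume.restrict ω) :=
  ⟨by
    rw [Measure.restrict_apply_univ]
    exact (measure_mono hω_sub).trans_lt (by simp)⟩

theorem abs_sineFn_le (k : ℕ) (x : ℝ) : |sineFn k x| ≤ √2 := by
  rw [sineFn, abs_mul, abs_of_nonneg (Real.sqrt_nonneg _)]
  exact mul_le_of_le_one_right (Real.sqrt_nonneg _) (Real.abs_sin_le_one _)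

theorem ae_fst_mem_Ioo (ω : Set ℝ) (T : ℝ) : ∀ᵐ p ∂ctrlMeasure ω T, p.1 ∈ Ioo 0 T := by
  have : ∀ᵐ t ∂volume.restrict (Ioo (0 : ℝ) T), t ∈ Ioo 0 T := ae_restrict_mem measurableSet_Ioo
  exact Measure.quasiMeasurePreserving_fst.ae this

theorem memLp_adjointFn (hω_sub : ω ⊆ Ioo 0 1) (k : ℕ) :
    MemLp (adjointFn T k) 2 (ctrlMeasure ω T) := by
  have := isFiniteMeasure_restrict hω_sub
  have : IsFiniteMeasure (volume.restrict (Ioo 0 T)) := ⟨by simp⟩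
  have hc : Continuous (adjointFn T k) := by
    unfold adjointFn
    have := continuous_sineFn k
    fun_prop
  refine MemLp.of_bound hc.aestronglyMeasurable (√2) ?_
  filter_upwards [ae_fst_mem_Ioo ω T] with p hp
  rw [adjointFn, Real.norm_eq_abs, abs_mul, Real.abs_exp]
  have h1 : Real.exp (-(eigval k * (T - p.1))) ≤ 1 := by
    rw [Real.exp_le_one_iff, neg_nonpos]
    exact mul_nonneg (eigval_pos k).le (by linarith [hp.2])
  have h2 := abs_sineFn_le k p.2
  calc _ ≤ 1 * √2 := by gcongr
    _ = _ := one_mul _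

/-- The `k`-th mode of the forcing term `u 1_ω`. -/
noncomputable def forcing (u : Control ω T) (k : ℕ) (t : ℝ) : ℝ := ∫ x in ω, u (t, x) * sineFn k x

/-- Adjoint solutions run backwards from time `T`; the substitution `t ↦ T - t` turns them into the
forward flow of the observability inequality. -/
theorem norm_sq_sum_adjointFn (hω_sub : ω ⊆ Ioo 0 1) (hT : 0 ≤ T) (S : Finset ℕ) (b : ℕ → ℝ) :
    ‖(∑ k ∈ S, b k • (memLp_adjointFn (T := T) hω_sub k).toLp _ : Control ω T)‖ ^ 2
      = ∫ τ in (0 : ℝ)..T, localEnergy ω S b τ := by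
  have := isFiniteMeasure_restrict hω_sub
  have hL := coeFn_sum_smul_toLp (fun k => memLp_adjointFn (T := T) hω_sub k) b S
  set f : Control ω T := ∑ k ∈ S, b k • (memLp_adjointFn (T := T) hω_sub k).toLp _ with hf
  have hfi := (Lp.memLp f).integrable_sq
  rw [← real_inner_self_eq_norm_sq, MeasureTheory.L2.inner_def]
  have h1 : ∫ p, inner ℝ (f p) (f p) ∂ctrlMeasure ω T
      = ∫ p, (∑ k ∈ S, b k * adjointFn T k p) ^ 2 ∂ctrlMeasure ω T := by
    apply integral_congr_ae
    filter_upwards [hL] with p hp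
    rw [hp]; simp [pow_two]
  have hgi : Integrable (fun p => (∑ k ∈ S, b k * adjointFn T k p) ^ 2) (ctrlMeasure ω T) := by
    refine hfi.congr ?_
    filter_upwards [hL] with p hp
    rw [hp]
  rw [h1, integral_prod _ hgi, setIntegral_Ioo_eq_intervalIntegral hT]
  have h2 := intervalIntegral.integral_comp_sub_left (a := 0) (b := T) (localEnergy ω S b) T
  simp only [sub_self, sub_zero] at h2
  rw [← h2]
  congr 1
  ext t
  rw [localEnergy]
  congr 1
  ext x
  congr 1
  refine Finset.sum_congr rfl fun k _ => ?_
  simp only [adjointFn, evol]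
  ring

/-- Fubini identifies the Duhamel integral with a scalar product, so cancelling every mode at time
`T` becomes a moment problem for `u`. -/
theorem inner_adjointFn (hω_sub : ω ⊆ Ioo 0 1) (hT : 0 ≤ T) (u : Control ω T) (k : ℕ) (c : ℝ) :
    Real.exp (-(eigval k * T)) * c + inner ℝ ((memLp_adjointFn (T := T) hω_sub k).toLp _) u
      = duhamel (eigval k) c (forcing u k) T := by
  have := isFiniteMeasure_restrict hω_sub
  rw [MeasureTheory.L2.inner_def, duhamel, mul_add]
  congr 1
  have h1 : ∫ p, inner ℝ ((memLp_adjointFn (T := T) hω_sub k).toLp _ p) (u p) ∂ctrlMeasure ω T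
      = ∫ p, adjointFn T k p * u p ∂ctrlMeasure ω T := by
    apply integral_congr_ae
    filter_upwards [(memLp_adjointFn (T := T) hω_sub k).coeFn_toLp] with p hp
    rw [hp]; simp [mul_comm]
  have h2 : Integrable (fun p => adjointFn T k p * u p) (ctrlMeasure ω T) :=
    (memLp_adjointFn hω_sub k).integrable_mul (Lp.memLp u)
  rw [h1, integral_prod _ h2,
    setIntegral_Ioo_eq_intervalIntegral hT, ← intervalIntegral.integral_const_mul]
  congr 1
  ext t
  rw [forcing, ← mul_assoc, ← Real.exp_add, ← integral_const_mul]
  congr 1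
  ext x
  simp only [adjointFn]
  rw [show -(eigval k * T) + eigval k * t = -(eigval k * (T - t)) by ring]
  ring

/-- The dual estimate required by `exists_of_moment_bound` is Cauchy–Schwarz, with Bessel's
inequality for `y₀` and observability for the other factor. -/
theorem exists_control (hω_sub : ω ⊆ Ioo 0 1) (hω_pos : 0 < volume ω) :
    ∃ C : ℝ, 0 < C ∧ ∀ T : ℝ, 0 < T → ∀ y₀ : L2, ∃ u : Control ω T,
      ‖u‖ ≤ C * Real.exp (C / T) * ‖y₀‖ ∧
      ∀ k, duhamel (eigval k) (inner ℝ (sine k) y₀) (forcing u k) T = 0 := by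
  obtain ⟨C, hC, h⟩ := observability hω_sub hω_pos
  refine ⟨C, hC, fun T hT y₀ => ?_⟩
  obtain ⟨u, hu1, hu2⟩ := exists_of_moment_bound
    (fun k => (memLp_adjointFn (T := T) hω_sub k).toLp _ : ℕ → Control ω T)
    (fun k => -(Real.exp (-(eigval k * T)) * inner ℝ (sine k) y₀))
    (K := C * Real.exp (C / T) * ‖y₀‖) (by positivity) (by
      intro b
      rw [Finsupp.linearCombination_apply, Finsupp.linearCombination_apply, Finsupp.sum,
        Finsupp.sum]
      apply abs_le_of_sq_le_sq _ (by positivity)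
      rw [mul_pow, norm_sq_sum_adjointFn hω_sub hT.le, mul_pow]
      have h1 : (∑ k ∈ b.support, b k • -(Real.exp (-(eigval k * T)) * inner ℝ (sine k) y₀)) ^ 2
          = (∑ k ∈ b.support, evol b T k * inner ℝ (sine k) y₀) ^ 2 := by
        rw [← neg_sq, ← Finset.sum_neg_distrib]
        congr 1
        refine Finset.sum_congr rfl fun k _ => ?_
        simp only [evol, smul_eq_mul]; ring
      rw [h1]
      refine (Finset.sum_mul_sq_le_sq_mul_sq _ _ _).trans ?_
      have h2 : ∑ k ∈ b.support, inner ℝ (sine k) y₀ ^ 2 ≤ ‖y₀‖ ^ 2 := by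
        have := orthonormal_sine.sum_inner_products_le y₀ (s := b.support)
        simpa using this
      have h3 : ∑ k ∈ b.support, evol b T k ^ 2
          ≤ (C * Real.exp (C / T)) ^ 2 * ∫ τ in (0 : ℝ)..T, localEnergy ω b.support b τ :=
        h T hT b.support b
      have h4 := mul_le_mul h3 h2 (Finset.sum_nonneg fun _ _ => sq_nonneg _)
        ((Finset.sum_nonneg fun _ _ => sq_nonneg _).trans h3)
      linarith)
  refine ⟨u, hu1, fun k => ?_⟩
  rw [← inner_adjointFn hω_sub hT.le, hu2 k]
  ring

/-! ### `H¹₀(0,1)` and its sine basis. -/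

theorem H10.ext {v w : H10} (h1 : H10.toL2 v = H10.toL2 w)
    (h2 : H10.weakDeriv v = H10.weakDeriv w) : v = w := by
  apply Subtype.ext
  exact (WithLp.ofLp_injective 2) (Prod.ext h1 h2)

theorem H10.inner_eq (v w : H10) : inner ℝ v w = inner ℝ (H10.toL2 v) (H10.toL2 w)
    + inner ℝ (H10.weakDeriv v) (H10.weakDeriv w) :=
  WithLp.prod_inner_apply (E := L2) (F := L2) (H10.subtypeL v) (H10.subtypeL w)

/-- An identity tested against test functions extends to `H¹₀(0,1)`. -/
theorem H10.inner_add_inner_eq_zero {p q : ℝ → ℝ} (hp : Continuous p) (hq : Continuous q)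
    (h : ∀ φ, IsTestFunction 0 1 φ → ∫ x in Ioo (0 : ℝ) 1, (p x * φ x + q x * deriv φ x) = 0)
    (v : H10) :
    inner ℝ (ofContinuous p hp) (H10.toL2 v) + inner ℝ (ofContinuous q hq) (H10.weakDeriv v) = 0 := by
  let w : WithLp 2 (L2 × L2) := WithLp.toLp 2 (ofContinuous p hp, ofContinuous q hq)
  have hle : H10Submodule ≤ (ℝ ∙ w)ᗮ := by
    apply Submodule.topologicalClosure_minimal _ _ (Submodule.isClosed_orthogonal _)
    rw [Submodule.span_le]
    rintro z ⟨φ, hφ, h1, h2⟩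
    rw [SetLike.mem_coe, Submodule.mem_orthogonal_singleton_iff_inner_right,
      WithLp.prod_inner_apply]
    change inner ℝ (ofContinuous p hp) z.fst + inner ℝ (ofContinuous q hq) z.snd = 0
    rw [inner_ofContinuous_left, inner_ofContinuous_left, ← integral_add]
    · refine Eq.trans ?_ (h φ hφ)
      apply integral_congr_ae
      filter_upwards [h1, h2] with x hx1 hx2
      rw [hx1, hx2]
    · exact (memLp_of_continuous hp 0 1).integrable_mul (Lp.memLp _)
    · exact (memLp_of_continuous hq 0 1).integrable_mul (Lp.memLp _)
  have := hle v.2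
  rw [Submodule.mem_orthogonal_singleton_iff_inner_right, WithLp.prod_inner_apply] at this
  exact this

theorem IsTestFunction.integral_deriv_mul_add {a b : ℝ} (hab : a ≤ b) {φ g g' : ℝ → ℝ}
    (hφ : IsTestFunction a b φ) (hg : ∀ x, HasDerivAt g (g' x) x) (hg' : Continuous g') :
    ∫ x in Ioo a b, (g' x * φ x + g x * deriv φ x) = 0 := by
  have hgc : Continuous g := continuous_iff_continuousAt.2 fun x => (hg x).continuousAt
  rw [setIntegral_Ioo_eq_intervalIntegral hab, intervalIntegral.integral_eq_sub_of_hasDerivAt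
    (f := fun x => g x * φ x)]
  · rw [hφ.eq_zero_of_notMem (x := a) (by simp), hφ.eq_zero_of_notMem (x := b) (by simp)]
    simp
  · intro x _
    exact (hg x).mul ((hφ.contDiff_one.differentiable one_ne_zero) x).hasDerivAt
  · exact ((hg'.mul hφ.continuous).add (hgc.mul hφ.continuous_deriv)).intervalIntegrable _ _

/-- The derivatives of the eigenfunctions as elements of `L²(0,1)`. -/
noncomputable def sineDerivL2 (k : ℕ) : L2 := ofContinuous (sineDeriv k) (continuous_sineDeriv k)

theorem ofContinuous_const_mul {f : ℝ → ℝ} (hf : Continuous f) (c : ℝ) :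
    ofContinuous (fun x => c * f x) (continuous_const.mul hf) = c • ofContinuous f hf :=
  MemLp.toLp_const_smul c (memLp_of_continuous hf 0 1)

/-- The weak form of `-e'' = λ e`. It converts the `H¹` structure into multiplication of the `L²`
coefficients. -/
theorem H10.inner_sineDeriv (k : ℕ) (v : H10) :
    inner ℝ (sineDerivL2 k) (H10.weakDeriv v) = eigval k * inner ℝ (sine k) (H10.toL2 v) := by
  have h1 := H10.inner_add_inner_eq_zero (p := fun x => -eigval k * sineFn k x)
    (q := sineDeriv k) (continuous_const.mul (continuous_sineFn k)) (continuous_sineDeriv k)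
    (fun φ hφ => hφ.integral_deriv_mul_add zero_le_one
      (fun x => by simpa using hasDerivAt_sineDeriv k x)
      (continuous_const.mul (continuous_sineFn k))) v
  rw [ofContinuous_const_mul (continuous_sineFn k), real_inner_smul_left] at h1
  change _ * inner ℝ (sine k) _ + inner ℝ (sineDerivL2 k) _ = 0 at h1
  linarith

/-- Since `H10` consists of pairs, this says that the second component is determined by the first.
Integrating by parts against a test function, the weak derivative of zero is orthogonal to every
test function. -/
theorem H10.eq_zero_of_toL2_eq_zero {v : H10} (h : H10.toL2 v = 0) : v = 0 := by
  have h2 : ∀ᵐ x ∂volume, x ∈ Ioo (0 : ℝ) 1 → H10.weakDeriv v x = 0 := by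
    apply isOpen_Ioo.ae_eq_zero_of_integral_contDiff_smul_eq_zero
    · have : IntegrableOn (H10.weakDeriv v) (Ioo 0 1) :=
        (Lp.memLp (H10.weakDeriv v)).integrable (by norm_num)
      exact this.locallyIntegrableOn
    · intro φ h1 h2 h3
      have hφ : IsTestFunction 0 1 φ := ⟨h1, h2, h3⟩
      have h4 := H10.inner_add_inner_eq_zero hφ.continuous_deriv hφ.continuous
        (fun ψ hψ => hψ.integral_deriv_mul_add zero_le_one
          (fun x => ((hφ.contDiff_one.differentiable one_ne_zero) x).hasDerivAt)
          hφ.continuous_deriv) v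
      rw [h, inner_zero_right, zero_add, inner_ofContinuous_left] at h4
      simp only [smul_eq_mul]
      rw [hφ.integral_eq, h4]
  apply H10.ext
  · rw [h, map_zero]
  · rw [map_zero]
    apply Lp.ext
    have h3 : ∀ᵐ x ∂volume.restrict (Ioo (0 : ℝ) 1), H10.weakDeriv v x = 0 := by
      rwa [ae_restrict_iff' measurableSet_Ioo]
    filter_upwards [h3, Lp.coeFn_zero ℝ 2 (volume.restrict (Ioo (0 : ℝ) 1))] with x hx h1
    rw [hx, h1]; rfl

theorem toLp_mem_H10Submodule_of_isTestFunction {φ : ℝ → ℝ} (hφ : IsTestFunction 0 1 φ) :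
    WithLp.toLp 2 (ofContinuous φ hφ.continuous, ofContinuous (deriv φ) hφ.continuous_deriv)
      ∈ H10Submodule :=
  Submodule.le_topologicalClosure _ (Submodule.subset_span
    ⟨φ, hφ, coeFn_ofContinuous hφ.continuous, coeFn_ofContinuous hφ.continuous_deriv⟩)

/-- The sine is not compactly supported in `(0,1)`, and cutting it off is avoided by passing to the
double orthogonal. A pair `(p, q)` orthogonal to the test functions satisfies `q' = p` weakly, hence
`q = c + ∫ p` by du Bois-Reymond. Integrating by parts against the sine, which vanishes at both
ends, gives orthogonality. -/
theorem sine_mem_H10Submodule (k : ℕ) :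
    WithLp.toLp 2 (sine k, sineDerivL2 k) ∈ H10Submodule := by
  have : CompleteSpace H10Submodule :=
    (Submodule.isClosed_topologicalClosure _).completeSpace_coe (α := WithLp 2 (L2 × L2))
  rw [← Submodule.orthogonal_orthogonal H10Submodule, Submodule.mem_orthogonal]
  intro w hw
  have hpi : IntegrableOn (w.fst : ℝ → ℝ) (Ioo 0 1) := (Lp.memLp w.fst).integrable (by norm_num)
  have hqi : IntegrableOn (w.snd : ℝ → ℝ) (Ioo 0 1) := (Lp.memLp w.snd).integrable (by norm_num)
  have hpc : IntegrableOn (fun x => ∫ s in (0 : ℝ)..x, w.fst s) (Ioo 0 1) := by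
    have h1 : IntervalIntegrable w.fst volume 0 1 := by
      rwa [intervalIntegrable_iff_integrableOn_Ioo_of_le zero_le_one]
    have h2 := (h1.absolutelyContinuousOnInterval_intervalIntegral (c := 0)
      (by simp)).continuousOn
    rw [uIcc_of_le zero_le_one] at h2
    exact (h2.integrableOn_Icc).mono_set Ioo_subset_Icc_self
  obtain ⟨c, hc⟩ := ae_eq_const_of_integral_deriv_mul_eq_zero zero_lt_one
    (g := fun x => w.snd x - ∫ s in (0 : ℝ)..x, w.fst s) (hqi.sub hpc) (by
      intro φ hφ
      have h1 := Submodule.mem_orthogonal _ _ |>.1 hw _ (toLp_mem_H10Submodule_of_isTestFunction hφ)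
      rw [WithLp.prod_inner_apply] at h1
      change inner ℝ (ofContinuous φ hφ.continuous) w.fst
        + inner ℝ (ofContinuous (deriv φ) hφ.continuous_deriv) w.snd = 0 at h1
      rw [inner_ofContinuous_left, inner_ofContinuous_left] at h1
      have h2 := integral_deriv_mul_primitive zero_le_one hφ.contDiff_one hpi 0
      rw [hφ.eq_zero_of_notMem (x := 0) (by simp), hφ.eq_zero_of_notMem (x := 1) (by simp)] at h2
      simp only [zero_add, zero_mul, sub_zero, zero_sub] at h2
      have hi1 : IntegrableOn (fun x => deriv φ x * w.snd x) (Ioo 0 1) :=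
        (memLp_of_continuous hφ.continuous_deriv 0 1).integrable_mul (Lp.memLp _)
      have hi2 : IntegrableOn (fun x => deriv φ x * ∫ s in (0 : ℝ)..x, w.fst s) (Ioo 0 1) :=
        IntegrableOn.continuousOn_mul_of_subset hφ.continuous_deriv.continuousOn hpc
          isCompact_Icc measurableSet_Ioo Ioo_subset_Icc_self
      simp_rw [mul_sub]
      rw [integral_sub hi1 hi2, h2]
      linarith)
  rw [WithLp.prod_inner_apply]
  change inner ℝ w.fst (sine k) + inner ℝ w.snd (sineDerivL2 k) = 0
  rw [real_inner_comm, real_inner_comm (sineDerivL2 k), sine, sineDerivL2, inner_ofContinuous_left,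
    inner_ofContinuous_left]
  have hd : deriv (sineFn k) = sineDeriv k := funext fun x => (hasDerivAt_sineFn k x).deriv
  have h3 := integral_deriv_mul_primitive zero_le_one
    ((contDiff_sineFn k).of_le (by exact_mod_cast le_top)) hpi c
  rw [sineFn_zero, sineFn_one, hd] at h3
  have h4 : ∫ x in Ioo (0 : ℝ) 1, sineDeriv k x * w.snd x
      = ∫ x in Ioo (0 : ℝ) 1, sineDeriv k x * (c + ∫ s in (0 : ℝ)..x, w.fst s) := by
    apply integral_congr_ae
    filter_upwards [hc] with x hx
    rw [← hx, sub_add_cancel]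
  rw [h4, h3]
  ring

/-- The eigenfunctions as elements of `H¹₀(0,1)`. -/
noncomputable def H10.sine (k : ℕ) : H10 := ⟨_, sine_mem_H10Submodule k⟩

theorem H10.toL2_sine (k : ℕ) : H10.toL2 (H10.sine k) = HeatControl.sine k := rfl

theorem H10.weakDeriv_sine (k : ℕ) : H10.weakDeriv (H10.sine k) = sineDerivL2 k := rfl

theorem H10.inner_sine (k : ℕ) (v : H10) :
    inner ℝ (H10.sine k) v = (1 + eigval k) * inner ℝ (HeatControl.sine k) (H10.toL2 v) := by
  rw [H10.inner_eq, H10.toL2_sine, H10.weakDeriv_sine, H10.inner_sineDeriv]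
  ring

/-- The eigenfunctions, normalised in `H¹₀(0,1)`. -/
noncomputable def H10.unitSine (k : ℕ) : H10 := (√(1 + eigval k))⁻¹ • H10.sine k

theorem sqrt_one_add_eigval_pos (k : ℕ) : 0 < √(1 + eigval k) :=
  Real.sqrt_pos.2 (by linarith [eigval_pos k])

theorem H10.inner_unitSine (k : ℕ) (v : H10) :
    inner ℝ (H10.unitSine k) v = √(1 + eigval k) * inner ℝ (HeatControl.sine k) (H10.toL2 v) := by
  have h := sqrt_one_add_eigval_pos k
  have h2 : √(1 + eigval k) * √(1 + eigval k) = 1 + eigval k :=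
    Real.mul_self_sqrt (by linarith [eigval_pos k])
  rw [H10.unitSine, real_inner_smul_left, H10.inner_sine, ← mul_assoc]
  congr 1
  rw [inv_mul_eq_iff_eq_mul₀ h.ne', h2]

theorem H10.orthonormal_unitSine : Orthonormal ℝ H10.unitSine := by
  rw [orthonormal_iff_ite]
  intro i j
  have h := sqrt_one_add_eigval_pos j
  rw [H10.inner_unitSine, H10.unitSine, map_smul, real_inner_smul_right, H10.toL2_sine,
    orthonormal_iff_ite.1 orthonormal_sine i j]
  split_ifs with hij
  · subst hij
    rw [mul_one, mul_inv_cancel₀ h.ne']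
  · simp

theorem H10.eq_zero_of_inner_unitSine_eq_zero (v : H10)
    (h : ∀ k, inner ℝ (H10.unitSine k) v = 0) : v = 0 := by
  apply H10.eq_zero_of_toL2_eq_zero
  apply eq_zero_of_inner_sine_eq_zero
  intro k
  have := h k
  rw [H10.inner_unitSine] at this
  exact (mul_eq_zero.1 this).resolve_left (sqrt_one_add_eigval_pos k).ne'

/-- The normalised eigenfunctions form a Hilbert basis of `H¹₀(0,1)`. -/
noncomputable def H10.sineBasis : HilbertBasis ℕ ℝ H10 :=
  HilbertBasis.mkOfOrthogonalEqBot H10.orthonormal_unitSine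
    (orthogonal_span_range_eq_bot H10.eq_zero_of_inner_unitSine_eq_zero)

theorem H10.sineBasis_apply (k : ℕ) : H10.sineBasis k = H10.unitSine k := by simp [H10.sineBasis]

/-- Functionals on `H¹₀(0,1)` are determined by their values on the eigenfunctions. -/
theorem HNegOne.ext_sine {F G : HNegOne} (h : ∀ k, F (H10.sine k) = G (H10.sine k)) : F = G := by
  apply ContinuousLinearMap.ext_on (s := range H10.sineBasis)
  · rw [Submodule.dense_iff_topologicalClosure_eq_top]
    exact H10.sineBasis.dense_span
  · rintro _ ⟨k, rfl⟩
    simp only [H10.sineBasis_apply, H10.unitSine, map_smul, h k]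

/-! ### Hilbert space valued functions built from their coefficients. -/

section HilbertBasis

variable {H : Type*} [NormedAddCommGroup H] [InnerProductSpace ℝ H] (b : HilbertBasis ℕ ℝ H)

theorem exists_forall_inner_eq {c : ℕ → ℝ} (hc : Summable fun k => c k ^ 2) :
    ∃ v : H, ∀ k, inner ℝ (b k) v = c k := by
  have hm : Memℓp c 2 := by
    rw [memℓp_gen_iff (by norm_num)]
    simpa using hc
  refine ⟨b.repr.symm ⟨c, hm⟩, fun k => ?_⟩
  rw [← b.repr_apply_apply, LinearIsometryEquiv.apply_symm_apply]

theorem hasSum_inner_sq (v : H) : HasSum (fun k => inner ℝ (b k) v ^ 2) (‖v‖ ^ 2) := by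
  have := b.hasSum_inner_mul_inner v v
  rw [real_inner_self_eq_norm_sq] at this
  simpa only [real_inner_comm, ← pow_two] using this

theorem eq_of_forall_inner_eq {v w : H} (h : ∀ k, inner ℝ (b k) v = inner ℝ (b k) w) : v = w := by
  apply b.repr.injective
  ext k
  rw [b.repr_apply_apply, b.repr_apply_apply, h k]

/-- A function with square integrable coefficients whose norms are square summable. -/
theorem exists_memLp_of_coeffs {α : Type*} [MeasurableSpace α] {μ : Measure α} {g : ℕ → α → ℝ}
    (hg : ∀ k, MemLp (g k) 2 μ) (hs : Summable fun k => ∫ t, g k t ^ 2 ∂μ) :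
    ∃ G : α → H, MemLp G 2 μ ∧ ∀ᵐ t ∂μ, ∀ k, inner ℝ (b k) (G t) = g k t := by
  have hint : ∀ k, Integrable (fun t => g k t ^ 2) μ := fun k => (hg k).integrable_sq
  have hlint : ∑' k, ∫⁻ t, ‖g k t ^ 2‖ₑ ∂μ ≠ ⊤ := by
    have h1 : ∀ k, ∫⁻ t, ‖g k t ^ 2‖ₑ ∂μ = ENNReal.ofReal (∫ t, g k t ^ 2 ∂μ) := fun k => by
      rw [ofReal_integral_eq_lintegral_ofReal (hint k)
        (Filter.Eventually.of_forall fun t => sq_nonneg _)]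
      congr 1; ext t
      rw [Real.enorm_eq_ofReal (sq_nonneg _)]
    simp_rw [h1]
    exact hs.tsum_ofReal_ne_top
  -- By Tonelli the sum of the squares has finite integral, so it is finite almost everywhere.
  have hsum : ∀ᵐ t ∂μ, Summable fun k => g k t ^ 2 := by
    have h2 : ∫⁻ t, ∑' k, ‖g k t ^ 2‖ₑ ∂μ ≠ ⊤ := by
      rwa [lintegral_tsum fun k => (hint k).1.enorm]
    filter_upwards [ae_lt_top' (AEMeasurable.tsum fun k => (hint k).1.enorm) h2] with t ht
    have h3 := ENNReal.summable_toReal ht.ne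
    simpa using h3
  classical
  let G : α → H := fun t => if h : Summable fun k => g k t ^ 2
    then (exists_forall_inner_eq b h).choose else 0
  have hG : ∀ᵐ t ∂μ, ∀ k, inner ℝ (b k) (G t) = g k t := by
    filter_upwards [hsum] with t ht
    simp only [G, dif_pos ht]
    exact (exists_forall_inner_eq b ht).choose_spec
  have hmeas : AEStronglyMeasurable G μ := by
    refine aestronglyMeasurable_of_tendsto_ae Filter.atTop
      (f := fun n t => ∑ k ∈ Finset.range n, g k t • b k) (fun n => ?_) ?_
    · exact Finset.aestronglyMeasurable_fun_sum _ fun k _ => (hg k).1.smul_const _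
    · filter_upwards [hG] with t ht
      have h1 := b.hasSum_repr (G t)
      simp only [b.repr_apply_apply, ht] at h1
      exact h1.tendsto_sum_nat
  refine ⟨G, ?_, hG⟩
  rw [memLp_two_iff_integrable_sq_norm hmeas]
  refine ⟨(hmeas.norm.pow 2), ?_⟩
  rw [HasFiniteIntegral]
  calc ∫⁻ t, ‖‖G t‖ ^ 2‖ₑ ∂μ = ∫⁻ t, ∑' k, ‖g k t ^ 2‖ₑ ∂μ := by
        apply lintegral_congr_ae
        filter_upwards [hG] with t ht
        have h5 := hasSum_inner_sq b (G t)
        simp only [ht] at h5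
        rw [Real.enorm_eq_ofReal (sq_nonneg _), ← h5.tsum_eq,
          ENNReal.ofReal_tsum_of_nonneg (fun k => sq_nonneg _) h5.summable]
        congr 1; ext k
        rw [Real.enorm_eq_ofReal (sq_nonneg _)]
    _ = ∑' k, ∫⁻ t, ‖g k t ^ 2‖ₑ ∂μ := lintegral_tsum fun k => (hint k).1.enorm
    _ < ⊤ := hlint.lt_top

/-- A function with continuous, uniformly square summable coefficients is continuous. -/
theorem exists_continuousOn_of_coeffs {X : Type*} [TopologicalSpace X] {s : Set X}
    {c : ℕ → X → ℝ} {M : ℕ → ℝ} (hc : ∀ k, ContinuousOn (c k) s)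
    (hM : ∀ k, ∀ t ∈ s, c k t ^ 2 ≤ M k) (hs : Summable M) :
    ∃ y : X → H, ContinuousOn y s ∧ ∀ t ∈ s, ∀ k, inner ℝ (b k) (y t) = c k t := by
  classical
  have hsum : ∀ t ∈ s, Summable fun k => c k t ^ 2 := fun t ht =>
    hs.of_nonneg_of_le (fun _ => sq_nonneg _) fun k => hM k t ht
  let y : X → H := fun t => if h : t ∈ s then (exists_forall_inner_eq b (hsum t h)).choose else 0
  have hy : ∀ t ∈ s, ∀ k, inner ℝ (b k) (y t) = c k t := by
    intro t ht
    simp only [y, dif_pos ht]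
    exact (exists_forall_inner_eq b (hsum t ht)).choose_spec
  refine ⟨y, ?_, hy⟩
  have hpart : ∀ n, ContinuousOn (fun t => ∑ k ∈ Finset.range n, c k t • b k) s := fun n =>
    continuousOn_finsetSum _ fun k _ => (hc k).smul continuousOn_const
  -- By Parseval the squared distance to a partial sum is the tail of the squared coefficients,
  -- dominated by the tail of `M` uniformly in `t`.
  have hunif : TendstoUniformlyOn (fun n t => ∑ k ∈ Finset.range n, c k t • b k) y Filter.atTop s := by
    rw [Metric.tendstoUniformlyOn_iff]
    intro ε hε
    have htail := tendsto_sum_nat_add M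
    have hev := (tendsto_order.1 htail).2 (ε ^ 2) (by positivity)
    filter_upwards [hev] with n hn t ht
    rw [dist_eq_norm]
    refine lt_of_pow_lt_pow_left₀ 2 hε.le (lt_of_le_of_lt ?_ hn)
    have h1 := hasSum_inner_sq b (y t - ∑ k ∈ Finset.range n, c k t • b k)
    have h2 : ∀ j, inner ℝ (b j) (y t - ∑ k ∈ Finset.range n, c k t • b k)
        = if j < n then 0 else c j t := by
      intro j
      rw [inner_sub_right, hy t ht j, inner_sum]
      simp only [real_inner_smul_right, orthonormal_iff_ite.1 b.orthonormal, mul_ite, mul_one,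
        mul_zero, Finset.sum_ite_eq, Finset.mem_range]
      split_ifs <;> simp
    simp only [h2] at h1
    have h3 := h1.summable.sum_add_tsum_nat_add n
    have h4 : ∑ j ∈ Finset.range n, (if j < n then 0 else c j t) ^ 2 = 0 :=
      Finset.sum_eq_zero fun j hj => by rw [if_pos (Finset.mem_range.1 hj), zero_pow two_ne_zero]
    rw [h1.tsum_eq, h4, zero_add] at h3
    rw [← h3]
    have h5 : Summable fun k => (if k + n < n then 0 else c (k + n) t) ^ 2 :=
      h1.summable.comp_injective (add_left_injective n)
    have h6 : Summable fun k => M (k + n) := hs.comp_injective (add_left_injective n)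
    refine h5.tsum_le_tsum (fun k => ?_) h6
    rw [if_neg (by omega)]
    exact hM _ t ht
  exact hunif.continuousOn (Filter.Frequently.of_forall hpart)

end HilbertBasis

/-! ### The modes of the forcing term. -/

section Forcing

variable {ω : Set ℝ} {T : ℝ}

theorem integrable_control_sq (u : Control ω T) :
    Integrable (fun p => u p ^ 2) (ctrlMeasure ω T) := (Lp.memLp u).integrable_sq

theorem ae_memLp_control (hω_sub : ω ⊆ Ioo 0 1) (u : Control ω T) :
    ∀ᵐ t ∂volume.restrict (Ioo 0 T), MemLp (fun x => u (t, x)) 2 (volume.restrict ω) := by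
  have := isFiniteMeasure_restrict hω_sub
  filter_upwards [(integrable_control_sq u).prod_right_ae,
    (Lp.memLp u).aestronglyMeasurable.prodMk_left] with t h1 h2
  rwa [memLp_two_iff_integrable_sq h2]

/-- The forcing term at a given time, as an element of `L²(0,1)`. -/
theorem exists_forcing_slice (hω_sub : ω ⊆ Ioo 0 1) (hω_meas : MeasurableSet ω) {f : ℝ → ℝ}
    (hf : MemLp f 2 (volume.restrict ω)) :
    ∃ g : L2, (∀ v : L2, inner ℝ g v = ∫ x in ω, f x * v x) ∧ ‖g‖ ^ 2 = ∫ x in ω, f x ^ 2 := by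
  have hr : (volume.restrict (Ioo (0 : ℝ) 1)).restrict ω = volume.restrict ω := by
    rw [Measure.restrict_restrict hω_meas, inter_eq_left.2 hω_sub]
  have hm : MemLp (ω.indicator f) 2 (volume.restrict (Ioo (0 : ℝ) 1)) := by
    rw [memLp_indicator_iff_restrict hω_meas, hr]
    exact hf
  have key : ∀ v : ℝ → ℝ, ∫ x in Ioo (0 : ℝ) 1, ω.indicator f x * v x = ∫ x in ω, f x * v x := by
    intro v
    rw [← hr, ← integral_indicator hω_meas]
    congr 1; ext x
    by_cases hx : x ∈ ω <;> simp [hx]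
  have hin : ∀ v : L2, inner ℝ (hm.toLp _) v = ∫ x in ω, f x * v x := by
    intro v
    rw [L2.inner_eq, ← key]
    apply integral_congr_ae
    filter_upwards [hm.coeFn_toLp] with x hx
    rw [hx]
  refine ⟨hm.toLp _, hin, ?_⟩
  rw [← real_inner_self_eq_norm_sq, hin]
  have h1 : ∀ᵐ x ∂volume.restrict ω, hm.toLp _ x = ω.indicator f x := by
    have := ae_restrict_of_ae (s := ω) hm.coeFn_toLp
    rwa [hr] at this
  apply integral_congr_ae
  filter_upwards [h1, ae_restrict_mem hω_meas] with x hx hxω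
  rw [hx, indicator_of_mem hxω, pow_two]

theorem setIntegral_mul_sine (hω_sub : ω ⊆ Ioo 0 1) (f : ℝ → ℝ) (k : ℕ) :
    ∫ x in ω, f x * sine k x = ∫ x in ω, f x * sineFn k x := by
  apply integral_congr_ae
  have : ∀ᵐ x ∂volume.restrict ω, sine k x = sineFn k x :=
    ae_restrict_of_ae_restrict_of_subset hω_sub (coeFn_ofContinuous (continuous_sineFn k))
  filter_upwards [this] with x hx
  rw [hx]

/-- Bessel's inequality for the time slices of `u 1_ω`. The exceptional null set does not depend on
`S`, so the bound can be integrated in time and summed over the modes. -/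
theorem ae_sum_forcing_sq_le (hω_sub : ω ⊆ Ioo 0 1) (hω_meas : MeasurableSet ω) (u : Control ω T) :
    ∀ᵐ t ∂volume.restrict (Ioo 0 T), ∀ S : Finset ℕ,
      ∑ k ∈ S, forcing u k t ^ 2 ≤ ∫ x in ω, u (t, x) ^ 2 := by
  filter_upwards [ae_memLp_control hω_sub u] with t ht S
  obtain ⟨g, hg, hn⟩ := exists_forcing_slice hω_sub hω_meas ht
  rw [← hn]
  have h1 := orthonormal_sine.sum_inner_products_le g (s := S)
  refine le_trans (le_of_eq (Finset.sum_congr rfl fun k _ => ?_)) h1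
  rw [Real.norm_eq_abs, sq_abs, real_inner_comm, hg, setIntegral_mul_sine hω_sub, forcing]

theorem memLp_forcing (hω_sub : ω ⊆ Ioo 0 1) (hω_meas : MeasurableSet ω) (u : Control ω T) (k : ℕ) :
    MemLp (forcing u k) 2 (volume.restrict (Ioo 0 T)) := by
  have := isFiniteMeasure_restrict hω_sub
  have hm : AEStronglyMeasurable (forcing u k) (volume.restrict (Ioo 0 T)) := by
    have h1 : AEStronglyMeasurable (fun p : ℝ × ℝ => u p * sineFn k p.2) (ctrlMeasure ω T) :=
      (Lp.memLp u).aestronglyMeasurable.mul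
        ((continuous_sineFn k).comp continuous_snd).aestronglyMeasurable
    exact h1.integral_prod_right'
  rw [memLp_two_iff_integrable_sq hm]
  refine (integrable_control_sq u).integral_prod_left.mono' (hm.pow 2) ?_
  filter_upwards [ae_sum_forcing_sq_le hω_sub hω_meas u] with t ht
  have := ht {k}
  rw [Finset.sum_singleton] at this
  rwa [Real.norm_eq_abs, abs_of_nonneg (sq_nonneg _)]

theorem summable_integral_forcing_sq (hω_sub : ω ⊆ Ioo 0 1) (hω_meas : MeasurableSet ω)
    (u : Control ω T) : Summable fun k => ∫ t in Ioo 0 T, forcing u k t ^ 2 := by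
  have := isFiniteMeasure_restrict hω_sub
  refine summable_of_sum_le (c := ∫ t in Ioo 0 T, ∫ x in ω, u (t, x) ^ 2)
    (fun k => integral_nonneg fun t => sq_nonneg _) fun S => ?_
  rw [← integral_finsetSum _ fun k _ => (memLp_forcing hω_sub hω_meas u k).integrable_sq]
  apply integral_mono_ae
  · exact integrable_finsetSum _ fun k _ => (memLp_forcing hω_sub hω_meas u k).integrable_sq
  · exact (integrable_control_sq u).integral_prod_left
  · filter_upwards [ae_sum_forcing_sq_le hω_sub hω_meas u] with t ht
    exact ht S

/-- The forcing term `u 1_ω` as an element of `L²((0,T); L²(0,1))`. -/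
theorem exists_forcing (hω_sub : ω ⊆ Ioo 0 1) (hω_meas : MeasurableSet ω) (u : Control ω T) :
    ∃ U : ℝ → L2, MemLp U 2 (volume.restrict (Ioo 0 T)) ∧
      ∀ᵐ t ∂volume.restrict (Ioo 0 T), ∀ v : L2, inner ℝ (U t) v = ∫ x in ω, u (t, x) * v x := by
  obtain ⟨U, hU, hUc⟩ := exists_memLp_of_coeffs sineBasis (memLp_forcing hω_sub hω_meas u)
    (summable_integral_forcing_sq hω_sub hω_meas u)
  refine ⟨U, hU, ?_⟩
  filter_upwards [hUc, ae_memLp_control hω_sub u] with t h1 h2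
  obtain ⟨g, hg, -⟩ := exists_forcing_slice hω_sub hω_meas h2
  have : U t = g := by
    apply eq_of_forall_inner_eq sineBasis
    intro k
    rw [h1, sineBasis_apply, real_inner_comm, hg, setIntegral_mul_sine hω_sub, forcing]
  rwa [this]

end Forcing

/-! ### The weak formulation in `H⁻¹(0,1)`, tested on eigenfunctions. -/

theorem L2.toHNegOne_sine (f : L2) (k : ℕ) :
    L2.toHNegOne f (H10.sine k) = inner ℝ (sine k) f :=
  real_inner_comm (sine k) f

/-- `L2.toHNegOne` as a continuous linear map. -/
noncomputable def toHNegOneL : L2 →L[ℝ] HNegOne :=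
  LinearMap.mkContinuous
    { toFun := L2.toHNegOne
      map_add' := fun f g => by ext v; simp [L2.toHNegOne]
      map_smul' := fun c f => by ext v; simp [L2.toHNegOne] }
    ‖H10.toL2‖ fun f => by
      rw [mul_comm]
      refine (ContinuousLinearMap.opNorm_comp_le _ _).trans ?_
      rw [innerSL_apply_norm]

/-- The operator `v ↦ -v''` from `H¹₀(0,1)` to `H⁻¹(0,1)`. -/
noncomputable def stiffness : H10 →L[ℝ] HNegOne :=
  LinearMap.mkContinuous
    { toFun := fun v => (innerSL ℝ (H10.weakDeriv v)).comp H10.weakDeriv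
      map_add' := fun f g => by ext v; simp
      map_smul' := fun c f => by ext v; simp }
    (‖H10.weakDeriv‖ * ‖H10.weakDeriv‖) fun v => by
      refine (ContinuousLinearMap.opNorm_comp_le _ _).trans ?_
      rw [innerSL_apply_norm, mul_right_comm]
      exact mul_le_mul_of_nonneg_right (H10.weakDeriv.le_opNorm v) (norm_nonneg _)

theorem stiffness_apply (v w : H10) :
    stiffness v w = inner ℝ (H10.weakDeriv v) (H10.weakDeriv w) := rfl

theorem inner_weakDeriv_sine (v : H10) (k : ℕ) :
    inner ℝ (H10.weakDeriv v) (H10.weakDeriv (H10.sine k))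
      = eigval k * inner ℝ (sine k) (H10.toL2 v) := by
  rw [real_inner_comm, H10.weakDeriv_sine, H10.inner_sineDeriv]

section TimeDerivative

variable {T : ℝ}

theorem integrableOn_smul_of_continuous {E : Type*} [NormedAddCommGroup E] [NormedSpace ℝ E]
    {F : ℝ → E} (hF : IntegrableOn F (Ioo 0 T)) {φ : ℝ → ℝ} (hφ : Continuous φ) :
    IntegrableOn (fun t => φ t • F t) (Ioo 0 T) :=
  IntegrableOn.continuousOn_smul_of_subset hφ.continuousOn hF isCompact_Icc measurableSet_Ioo
    Ioo_subset_Icc_self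

theorem integral_smul_apply {F : ℝ → HNegOne} (hF : IntegrableOn F (Ioo 0 T)) {φ : ℝ → ℝ}
    (hφ : Continuous φ) (v : H10) :
    (∫ t in Ioo 0 T, φ t • F t) v = ∫ t in Ioo 0 T, φ t * F t v := by
  rw [ContinuousLinearMap.integral_apply (integrableOn_smul_of_continuous hF hφ)]
  rfl

theorem integrableOn_toHNegOne {y : ℝ → L2} (hy : ContinuousOn y (Icc 0 T)) :
    IntegrableOn (fun t => L2.toHNegOne (y t)) (Ioo 0 T) :=
  ((toHNegOneL.continuous.comp_continuousOn hy).integrableOn_Icc).mono_set Ioo_subset_Icc_self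

/-- The weak time derivative may be tested on eigenfunctions. -/
theorem hasWeakTimeDeriv_iff {y : ℝ → L2} (hy : ContinuousOn y (Icc 0 T)) {y' : ℝ → HNegOne}
    (hy' : IntegrableOn y' (Ioo 0 T)) :
    HasWeakTimeDeriv T (fun t => L2.toHNegOne (y t)) y' ↔
      ∀ k φ, IsTestFunction 0 T φ → ∫ t in Ioo 0 T, deriv φ t * inner ℝ (sine k) (y t)
        = -∫ t in Ioo 0 T, φ t * y' t (H10.sine k) := by
  have key : ∀ k φ, IsTestFunction 0 T φ →
      ((∫ t in Ioo 0 T, deriv φ t • L2.toHNegOne (y t)) (H10.sine k)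
        = ∫ t in Ioo 0 T, deriv φ t * inner ℝ (sine k) (y t)) ∧
      ((-∫ t in Ioo 0 T, φ t • y' t) (H10.sine k)
        = -∫ t in Ioo 0 T, φ t * y' t (H10.sine k)) := by
    intro k φ hφ
    rw [integral_smul_apply (integrableOn_toHNegOne hy) hφ.continuous_deriv,
      neg_apply, integral_smul_apply hy' hφ.continuous]
    simp only [L2.toHNegOne_sine, and_self]
  constructor
  · intro h k φ hφ
    rw [← (key k φ hφ).1, ← (key k φ hφ).2, h φ hφ]
  · intro h φ hφ
    apply HNegOne.ext_sine
    intro k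
    rw [(key k φ hφ).1, (key k φ hφ).2, h k φ hφ]

end TimeDerivative

/-! ### Existence and uniqueness of solutions. -/

section Solutions

variable {ω : Set ℝ} {T : ℝ}

theorem one_le_eigval (k : ℕ) : 1 ≤ eigval k := by
  have h : 1 ≤ freq k := by
    have : 1 ≤ Real.pi := by linarith [Real.pi_gt_three]
    have : (0 : ℝ) ≤ k := by positivity
    unfold freq
    nlinarith
  exact one_le_pow₀ h

/-- The solution of the controlled heat equation, mode by mode. -/
theorem exists_isSolution (hω_sub : ω ⊆ Ioo 0 1) (hω_meas : MeasurableSet ω) (hT : 0 < T)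
    (y₀ : L2) (u : Control ω T) :
    ∃ y : ℝ → L2, IsSolution ω T y₀ u y ∧ ∀ t ∈ Icc 0 T, ∀ k,
      inner ℝ (sine k) (y t) = duhamel (eigval k) (inner ℝ (sine k) y₀) (forcing u k) t := by
  have : IsFiniteMeasure (volume.restrict (Ioo 0 T)) := ⟨by simp⟩
  set c : ℕ → ℝ → ℝ := fun k => duhamel (eigval k) (inner ℝ (sine k) y₀) (forcing u k) with hc
  -- A summable bound for both `sup c²` and `λ ∫ c²`, by the energy estimate and `λ ≥ 1`.
  set M : ℕ → ℝ := fun k => inner ℝ (sine k) y₀ ^ 2 + ∫ t in Ioo 0 T, forcing u k t ^ 2 with hM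
  have hfm := memLp_forcing hω_sub hω_meas u
  have hfi : ∀ k, IntegrableOn (forcing u k) (Ioo 0 T) := fun k => (hfm k).integrable (by norm_num)
  have hMs : Summable M := by
    refine Summable.add ?_ (summable_integral_forcing_sq hω_sub hω_meas u)
    simpa using orthonormal_sine.inner_products_summable y₀
  have hcc : ∀ k, ContinuousOn (c k) (Icc 0 T) := fun k => duhamel_continuousOn hT.le (hfi k)
  have henergy : ∀ k, ∀ t ∈ Icc 0 T,
      c k t ^ 2 + eigval k * ∫ s in (0 : ℝ)..t, c k s ^ 2 ≤ M k := by
    intro k t ht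
    refine (duhamel_energy (eigval_pos k) (hfm k) ht).trans ?_
    have h1 : 0 ≤ ∫ s in Ioo 0 T, forcing u k s ^ 2 := integral_nonneg fun _ => sq_nonneg _
    have h2 := mul_le_of_le_one_left h1 (inv_le_one_of_one_le₀ (one_le_eigval k))
    simp only [hM]
    linarith
  have hcM : ∀ k, ∀ t ∈ Icc 0 T, c k t ^ 2 ≤ M k := by
    intro k t ht
    have h1 : 0 ≤ ∫ s in (0 : ℝ)..t, c k s ^ 2 :=
      intervalIntegral.integral_nonneg ht.1 fun _ _ => sq_nonneg _
    have h2 := mul_nonneg (eigval_pos k).le h1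
    linarith [henergy k t ht]
  obtain ⟨y, hyc, hy⟩ := exists_continuousOn_of_coeffs sineBasis hcc hcM hMs
  simp only [sineBasis_apply] at hy
  have hcsq : ∀ k, IntegrableOn (fun t => c k t ^ 2) (Ioo 0 T) := fun k =>
    ((hcc k).pow 2).integrableOn_Icc.mono_set Ioo_subset_Icc_self
  have hcmem : ∀ k, MemLp (c k) 2 (volume.restrict (Ioo 0 T)) := fun k =>
    (memLp_two_iff_integrable_sq
      (((hcc k).mono Ioo_subset_Icc_self).aestronglyMeasurable measurableSet_Ioo)).2 (hcsq k)
  obtain ⟨Y, hYm, hY⟩ := exists_memLp_of_coeffs H10.sineBasis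
    (g := fun k t => √(1 + eigval k) * c k t) (fun k => (hcmem k).const_mul _) (by
      refine Summable.of_nonneg_of_le (fun k => integral_nonneg fun t => sq_nonneg _) (fun k => ?_)
        -- In `(1 + λ) ∫ c²` the term `∫ c²` is at most `T M` and the term `λ ∫ c²` at most `M`.
        (hMs.mul_left (T + 1))
      simp only [mul_pow]
      rw [integral_const_mul, Real.sq_sqrt (by linarith [eigval_pos k]),
        setIntegral_Ioo_eq_intervalIntegral hT.le]
      have h1 := henergy k T ⟨hT.le, le_rfl⟩
      have h2 : ∫ s in (0 : ℝ)..T, c k s ^ 2 ≤ ∫ _ in (0 : ℝ)..T, M k :=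
        intervalIntegral.integral_mono_on hT.le (by
          rw [intervalIntegrable_iff_integrableOn_Ioo_of_le hT.le]; exact hcsq k) (by simp)
          (hcM k)
      rw [intervalIntegral.integral_const, smul_eq_mul, sub_zero] at h2
      have h3 := sq_nonneg (c k T)
      linarith)
  have hYc : ∀ᵐ t ∂volume.restrict (Ioo 0 T), ∀ k, inner ℝ (sine k) (H10.toL2 (Y t)) = c k t := by
    filter_upwards [hY] with t ht k
    have h1 := ht k
    rw [H10.sineBasis_apply, H10.inner_unitSine] at h1
    exact mul_left_cancel₀ (sqrt_one_add_eigval_pos k).ne' h1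
  obtain ⟨U, hUm, hU⟩ := exists_forcing hω_sub hω_meas u
  -- The time derivative is read off the equation as forcing plus `Y''`; its weak identity then
  -- needs checking on eigenfunctions only.
  have hy'm : MemLp (fun t => toHNegOneL (U t) - stiffness (Y t)) 2 (volume.restrict (Ioo 0 T)) :=
    (toHNegOneL.comp_memLp' hUm).sub (stiffness.comp_memLp' hYm)
  refine ⟨y, ⟨hyc, ?_, Y, fun t => toHNegOneL (U t) - stiffness (Y t), hYm, ?_, hy'm, ?_, ?_⟩, hy⟩
  · apply eq_of_forall_inner_eq sineBasis
    intro k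
    rw [sineBasis_apply, hy 0 ⟨le_rfl, hT.le⟩, hc]
    exact duhamel_zero _ _ _
  · filter_upwards [hYc, ae_restrict_mem measurableSet_Ioo] with t h1 h2
    apply eq_of_forall_inner_eq sineBasis
    intro k
    rw [sineBasis_apply, h1, hy t (Ioo_subset_Icc_self h2)]
  · rw [hasWeakTimeDeriv_iff hyc (hy'm.integrable (by norm_num))]
    intro k φ hφ
    have h1 := duhamel_weak (l := eigval k) (a := inner ℝ (sine k) y₀) hT.le (hfi k) hφ
    have h2 : ∫ t in Ioo 0 T, deriv φ t * inner ℝ (sine k) (y t)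
        = ∫ t in Ioo 0 T, deriv φ t * c k t :=
      setIntegral_congr_fun measurableSet_Ioo fun t ht => by
        simp only [hy t (Ioo_subset_Icc_self ht)]
    rw [h2]
    refine h1.trans (congrArg _ ?_)
    apply integral_congr_ae
    filter_upwards [hYc, hU] with t h3 h4
    congr 1
    change _ = L2.toHNegOne (U t) (H10.sine k) - stiffness (Y t) (H10.sine k)
    rw [stiffness_apply, inner_weakDeriv_sine, h3, L2.toHNegOne_sine, real_inner_comm (U t), h4,
      setIntegral_mul_sine hω_sub, ← forcing]
    ring
  · filter_upwards [hU] with t h1 v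
    rw [← h1]
    change inner ℝ (U t) (H10.toL2 v) - stiffness (Y t) v + stiffness (Y t) v = _
    ring

/-- A continuous function which solves `d' = -l d`, `d 0 = 0` weakly vanishes. -/
theorem eq_zero_of_weak_ode (hT : 0 < T) {l : ℝ} {d : ℝ → ℝ} (hd : ContinuousOn d (Icc 0 T))
    (h0 : d 0 = 0) (h : ∀ φ, IsTestFunction 0 T φ →
      ∫ t in Ioo 0 T, deriv φ t * d t = l * ∫ t in Ioo 0 T, φ t * d t) :
    ∀ t ∈ Icc 0 T, d t = 0 := by
  have hdi : IntegrableOn d (Ioo 0 T) := hd.integrableOn_Icc.mono_set Ioo_subset_Icc_self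
  have hexp : ContDiff ℝ (⊤ : ℕ∞) (fun t : ℝ => Real.exp (l * t)) := by fun_prop
  have hg : ContinuousOn (fun t => Real.exp (l * t) * d t) (Icc 0 T) :=
    hexp.continuous.continuousOn.mul hd
  -- Integrating factor: testing with `ψ exp(lt)` shows that `exp(lt) d` has zero weak derivative.
  -- It is therefore constant, and by continuity equal to its value at time zero.
  obtain ⟨c, hc⟩ := ae_eq_const_of_integral_deriv_mul_eq_zero hT
    (g := fun t => Real.exp (l * t) * d t)
    (hg.integrableOn_Icc.mono_set Ioo_subset_Icc_self) (by
      intro ψ hψ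
      have hφ := hψ.contDiff_mul hexp
      have hder : deriv (fun t => ψ t * Real.exp (l * t))
          = fun t => deriv ψ t * Real.exp (l * t) + l * (ψ t * Real.exp (l * t)) := by
        ext t
        have h1 : HasDerivAt (fun t : ℝ => Real.exp (l * t)) (Real.exp (l * t) * l) t := by
          simpa using ((hasDerivAt_id t).const_mul l).exp
        have h2 := ((hψ.contDiff_one.differentiable one_ne_zero) t).hasDerivAt.mul h1
        refine (HasDerivAt.deriv h2).trans ?_
        ring
      have h3 := h _ hφ
      rw [hder] at h3
      have hi1 : IntegrableOn (fun t => deriv ψ t * (Real.exp (l * t) * d t)) (Ioo 0 T) :=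
        integrableOn_smul_of_continuous (hg.integrableOn_Icc.mono_set Ioo_subset_Icc_self)
          hψ.continuous_deriv
      have hi2 : IntegrableOn (fun t => ψ t * Real.exp (l * t) * d t) (Ioo 0 T) :=
        integrableOn_smul_of_continuous hdi hφ.continuous
      have h4 : ∫ t in Ioo 0 T, (deriv ψ t * Real.exp (l * t) + l * (ψ t * Real.exp (l * t))) * d t
          = (∫ t in Ioo 0 T, deriv ψ t * (Real.exp (l * t) * d t))
            + l * ∫ t in Ioo 0 T, ψ t * Real.exp (l * t) * d t := by
        rw [← integral_const_mul, ← integral_add hi1 (hi2.const_mul l)]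
        congr 1; ext t; ring
      rw [h4] at h3
      linarith)
  have hc' : (fun t => Real.exp (l * t) * d t) =ᵐ[volume.restrict (Icc 0 T)] fun _ => c := by
    rwa [← restrict_Ioo_eq_restrict_Icc]
  have heq := Measure.eqOn_Icc_of_ae_eq volume hT.ne hc' hg continuousOn_const
  have hc0 : c = 0 := by
    have := heq ⟨le_rfl, hT.le⟩
    simpa [h0] using this.symm
  intro t ht
  have := heq ht
  simp only [hc0] at this
  exact (mul_eq_zero.1 this).resolve_left (Real.exp_pos _).ne'

/-- Testing the equation with an eigenfunction turns it into a scalar weak equation whose time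
derivative is `r`. -/
theorem IsSolution.modes {y₀ : L2} {u : Control ω T} {z : ℝ → L2} (hz : IsSolution ω T y₀ u z)
    (k : ℕ) : ∃ r : ℝ → ℝ, IntegrableOn r (Ioo 0 T) ∧
      (∀ φ, IsTestFunction 0 T φ → ∫ t in Ioo 0 T, deriv φ t * inner ℝ (sine k) (z t)
        = -∫ t in Ioo 0 T, φ t * r t) ∧
      ∀ᵐ t ∂volume.restrict (Ioo 0 T), r t + eigval k * inner ℝ (sine k) (z t)
        = ∫ x in ω, u (t, x) * sine k x := by
  have : IsFiniteMeasure (volume.restrict (Ioo 0 T)) := ⟨by simp⟩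
  obtain ⟨Y, y', -, hY, hy', hw, he⟩ := hz.equation
  have hi : IntegrableOn y' (Ioo 0 T) := hy'.integrable (by norm_num)
  refine ⟨fun t => y' t (H10.sine k), hi.apply_continuousLinearMap _, fun φ hφ =>
    (hasWeakTimeDeriv_iff hz.continuousOn hi).1 hw k φ hφ, ?_⟩
  filter_upwards [hY, he] with t h1 h2
  have h3 := h2 (H10.sine k)
  rwa [inner_weakDeriv_sine, h1] at h3

/-- By linearity the control cancels in the difference of two solutions, each mode of which solves
the homogeneous scalar equation with zero initial value. -/
theorem IsSolution.eqOn {y₀ : L2} {u : Control ω T} {y z : ℝ → L2} (hT : 0 < T)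
    (hy : IsSolution ω T y₀ u y) (hz : IsSolution ω T y₀ u z) : EqOn z y (Icc 0 T) := by
  intro t ht
  apply eq_of_forall_inner_eq sineBasis
  intro k
  rw [sineBasis_apply]
  obtain ⟨ry, hyi, hy1, hy2⟩ := hy.modes k
  obtain ⟨rz, hzi, hz1, hz2⟩ := hz.modes k
  have hcy : ContinuousOn (fun t => inner ℝ (sine k) (y t)) (Icc 0 T) :=
    continuousOn_const.inner hy.continuousOn
  have hcz : ContinuousOn (fun t => inner ℝ (sine k) (z t)) (Icc 0 T) :=
    continuousOn_const.inner hz.continuousOn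
  have h := eq_zero_of_weak_ode hT (l := eigval k)
    (d := fun t => inner ℝ (sine k) (z t) - inner ℝ (sine k) (y t)) (hcz.sub hcy)
    (by simp [hy.initial, hz.initial]) (by
      intro φ hφ
      have hint : ∀ {F : ℝ → ℝ} {ψ : ℝ → ℝ}, IntegrableOn F (Ioo 0 T) → Continuous ψ →
          IntegrableOn (fun t => ψ t * F t) (Ioo 0 T) := fun hF hψ =>
        integrableOn_smul_of_continuous hF hψ
      simp_rw [mul_sub]
      rw [integral_sub (hint (hcz.integrableOn_Icc.mono_set Ioo_subset_Icc_self)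
        hφ.continuous_deriv) (hint (hcy.integrableOn_Icc.mono_set Ioo_subset_Icc_self)
        hφ.continuous_deriv), hz1 φ hφ, hy1 φ hφ, neg_sub_neg,
        ← integral_sub (hint hyi hφ.continuous) (hint hzi hφ.continuous), ← integral_const_mul]
      apply integral_congr_ae
      filter_upwards [hy2, hz2] with s h1 h2
      linear_combination φ s * h1 - φ s * h2) t ht
  linarith

end Solutions

end HeatControl

/-! ### Conclusion. -/

theorem mainTheorem8 (ω : Set ℝ) (hω_sub : ω ⊆ Set.Ioo 0 1) (hω_meas : MeasurableSet ω)
    (hω_pos : 0 < MeasureTheory.volume ω) :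
    HeatControl.SmallTimeNullControllable ω ∧
      ∃ C : ℝ, 0 < C ∧ ∀ T : ℝ, 0 < T → ∀ y₀ : HeatControl.L2,
        ∃ u : HeatControl.Control ω T,
          HeatControl.SteersToZero ω T y₀ u ∧ ‖u‖ ≤ C * Real.exp (C / T) * ‖y₀‖ := by
  obtain ⟨C, hC, h⟩ := HeatControl.exists_control hω_sub hω_pos
  have key : ∀ T : ℝ, 0 < T → ∀ y₀ : HeatControl.L2, ∃ u : HeatControl.Control ω T,
      HeatControl.SteersToZero ω T y₀ u ∧ ‖u‖ ≤ C * Real.exp (C / T) * ‖y₀‖ := by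
    intro T hT y₀
    obtain ⟨u, hu, hmodes⟩ := h T hT y₀
    obtain ⟨y, hy, hyc⟩ := HeatControl.exists_isSolution hω_sub hω_meas hT y₀ u
    refine ⟨u, ⟨y, hy, fun z hz => hy.eqOn hT hz, ?_⟩, hu⟩
    apply HeatControl.eq_zero_of_inner_sine_eq_zero
    intro k
    rw [hyc T ⟨hT.le, le_rfl⟩, hmodes]
  exact ⟨fun T hT y₀ => (key T hT y₀).imp fun u hu => hu.1, C, hC, key⟩
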